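/- **Theorem (variance bound for the multimodal case without mixing between modes).** Let $n\ge 1$, let $(E,\mathcal E)$ be a Polish space with its Borel $\sigma$-algebra, and let $\mu_0,\dots,\mu_n=\mu$ be probability measures on $E$ such that, for $0\le k\le n-1$, $\mu_{k+1}\ll\mu_k$ with a (version of the) density $g_{k,k+1}=d\mu_{k+1}/d\mu_k:E\to[0,\infty)$ that is bounded; put $\Gamma_g=\max_{0\le k\le n-1}\sup_{x\in E} g_{k,k+1}(x)$. For $1\le k\le n$ let $K_k$ be a Markov kernel on $E$ leaving $\mu_k$ invariant. Let $E=F^{(1)}\sqcup\dots\sqcup F^{(m)}$ be a measurable partition (the modes) with $\mu_k(F^{(r)})>0$ for $1\le k\le n$, $1\le r\le m$, and suppose that there is no mixing between the modes: $K_k(x,F^{(r)})=1$ for all $x\in F^{(r)}$, $1\le r\le m$, $1\le k\le n$. Let $K_{k,r}$ be the restriction of $K_k$ to $F^{(r)}$ and $\mu_{k,r}=\mu_k(\cdot\cap F^{(r)})/\mu_k(F^{(r)})$, identify $\mu_{k,r}$ with the operator $f\mapsto\mu_{k,r}(f)$ (a constant function), and set $$\gamma_K^{\mathrm{loc}}=1-\max_{1\le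 k\le n,\,1\le r\le m}\ \sup\bigl\{\|(K_{k,r}-\mu_{k,r})f\|_{L^2(\mu_{k,r})}:\ \mu_{k,r}(f^2)\le 1\bigr\},\qquad A=\max_{0\le j<k\le n,\ 1\le r\le m}\frac{\mu_k(F^{(r)})}{\mu_j(F^{(r)})}.$$ For $N\ge1$ consider the sequential Monte Carlo algorithm with $N$ particles: $\xi_0^1,\dots,\xi_0^N$ are i.i.d. with law $\mu_0$; given the particles $\xi_k^1,\dots,\xi_k^N$ at stage $k<n$, one draws $N$ i.i.d. particles, each equal to $\xi_k^i$ with probability $g_{k,k+1}(\xi_k^i)/\sum_{l} g_{k,k+1}(\xi_k^l)$ (if all these weights vanish, the particles are kept), and then moves each of them independently with the kernel $K_{k+1}$, which gives $\xi_{k+1}^1,\dots,\xi_{k+1}^N$. Let $\mu_n^N=\frac1N\sum_{i=1}^N\delta_{\xi_n^i}$. Assume that $\Gamma_g\,(1-\gamma_K^{\mathrm{loc}})^2<1$, and let $\phi:E\to\mathbb R$ be measurable with $\mu(\phi)=0$ and $\mu(|\phi|^{2+\varepsilon})<\infty$ for some $\varepsilon>0$. Then the central limit theorem $$N^{1/2}\,(\mu_n^N-\mu)(\phi)\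 \longrightarrow\ \mathcal N(0,V_n(\phi))\quad\text{in distribution as } N\to\infty$$ holds with $$V_n(\phi)=\sum_{k=0}^n\bigl\|G_{k,k+1}K_{k+1}G_{k+1,k+2}K_{k+2}\cdots G_{n-1,n}K_n\,\phi\bigr\|_{L^2(\mu_k)}^2,$$ where $G_{k,k+1}f=g_{k,k+1}f$ and $K_kf(x)=\int f(y)\,K_k(x,dy)$ (the term $k=n$ being $\|\phi\|_{L^2(\mu_n)}^2$), and $$V_n(\phi)\ \le\ \left(1+\frac{n\,A\,\Gamma_g}{1-(1-\gamma_K^{\mathrm{loc}})^2\,\Gamma_g}\right)\mathrm{Var}_{\mu}(\phi).$$ -/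

import Mathlib

open MeasureTheory ProbabilityTheory Filter Topology
open scoped NNReal ENNReal

noncomputable section

namespace SMC

variable {E : Type*} [MeasurableSpace E]

/-! ### The particle system -/

/-- Conditionally independent sampling: given `x`, the coordinates are independent and the
`i`-th one has law `κ i x`. -/
def productKernel {X : Type*} [MeasurableSpace X] {N : ℕ} (κ : Fin N → Kernel X E)
    [∀ i, IsMarkovKernel (κ i)] : Kernel X (Fin N → E) where
  toFun x := Measure.pi fun i => κ i x
  measurable' := by
    refine Measurable.measure_of_isPiSystem_of_isProbabilityMeasure
      (S := Set.pi Set.univ '' Set.pi Set.univ fun _ : Fin N => {s : Set E | MeasurableSet s})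
      generateFrom_pi.symm isPiSystem_pi ?_
    rintro _ ⟨s, hs, rfl⟩
    simp only [Measure.pi_pi]
    exact Finset.measurable_prod _ fun i _ => (κ i).measurable_coe (hs i (Set.mem_univ i))

instance {X : Type*} [MeasurableSpace X] {N : ℕ} (κ : Fin N → Kernel X E)
    [∀ i, IsMarkovKernel (κ i)] : IsMarkovKernel (productKernel κ) :=
  ⟨fun x => inferInstanceAs (IsProbabilityMeasure (Measure.pi fun i => κ i x))⟩

/-- Law of the `i`-th resampled particle given the current particles `x`: it equals `x j` with
probability `w (x j) / ∑ l, w (x l)`. If all the weights vanish, the particle is kept. -/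
def resampleKernel (N : ℕ) (w : E → ℝ≥0) (hw : Measurable w) (i : Fin N) :
    Kernel (Fin N → E) E where
  toFun x := if ∑ l, w (x l) = 0 then Measure.dirac (x i)
    else ∑ j, (w (x j) / ∑ l, w (x l)) • Measure.dirac (x j)
  measurable' := by
    have hwj : ∀ j : Fin N, Measurable fun x : Fin N → E => w (x j) :=
      fun j => hw.comp (measurable_pi_apply j)
    have hsum : Measurable fun x : Fin N → E => ∑ l, w (x l) :=
      Finset.measurable_sum _ fun l _ => hwj l
    have hd : ∀ j : Fin N, Measurable fun x : Fin N → E => Measure.dirac (x j) :=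
      fun j => Measure.measurable_dirac.comp (measurable_pi_apply j)
    refine Measurable.ite (hsum (measurableSet_singleton 0)) (hd i) ?_
    refine Measure.measurable_of_measurable_coe _ fun s hs => ?_
    simp only [Measure.coe_finsetSum, Finset.sum_apply, Measure.smul_apply]
    refine Finset.measurable_sum _ fun j _ => ?_
    exact ((hwj j).div hsum).smul ((Measure.measurable_coe hs).comp (hd j))

instance (N : ℕ) (w : E → ℝ≥0) (hw : Measurable w) (i : Fin N) :
    IsMarkovKernel (resampleKernel N w hw i) := by
  refine ⟨fun x => ⟨?_⟩⟩
  change (if ∑ l, w (x l) = 0 then Measure.dirac (x i)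
    else ∑ j, (w (x j) / ∑ l, w (x l)) • Measure.dirac (x j) : Measure E) Set.univ = 1
  split_ifs with h
  · simp
  · simp only [Measure.coe_finsetSum, Finset.sum_apply, Measure.smul_apply, measure_univ]
    simp only [ENNReal.smul_def, smul_eq_mul, mul_one]
    rw [← ENNReal.ofNNReal_finsetSum, ← Finset.sum_div, div_self h, ENNReal.coe_one]

/-- Law of the `N` particles at stage `k` of the sequential Monte Carlo algorithm: start from `N`
independent samples from `μ₀`; to pass from stage `k` to stage `k + 1`, first resample (`N`
independent multinomial draws with weights `g k`), then move each particle independently with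
the Markov kernel `K (k + 1)`. -/
def particleLaw (μ₀ : Measure E) (g : ℕ → E → ℝ≥0) (hg : ∀ k, Measurable (g k))
    (K : ℕ → Kernel E E) [∀ k, IsMarkovKernel (K k)] (N : ℕ) : ℕ → Measure (Fin N → E)
  | 0 => Measure.pi fun _ => μ₀
  | k + 1 =>
      ((particleLaw μ₀ g hg K N k).bind (productKernel fun i => resampleKernel N (g k) (hg k) i)).bind
        (productKernel fun i : Fin N => (K (k + 1)).comap (fun x => x i) (measurable_pi_apply i))

instance (μ₀ : Measure E) [IsProbabilityMeasure μ₀] (g : ℕ → E → ℝ≥0) (hg : ∀ k, Measurable (g k))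
    (K : ℕ → Kernel E E) [∀ k, IsMarkovKernel (K k)] (N k : ℕ) :
    IsProbabilityMeasure (particleLaw μ₀ g hg K N k) := by
  induction k with
  | zero => exact inferInstanceAs (IsProbabilityMeasure (Measure.pi fun _ : Fin N => μ₀))
  | succ k ih =>
    unfold particleLaw
    infer_instance

/-- The rescaled error `N^{1/2} (μ^N - μ)(φ)`, with `μ^N` the empirical measure of the
particles `x`. -/
def scaledError (μ : Measure E) (φ : E → ℝ) (N : ℕ) (x : Fin N → E) : ℝ :=
  √(N : ℝ) * ((N : ℝ)⁻¹ * ∑ i, φ (x i) - ∫ y, φ y ∂μ)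

/-! ### The asymptotic variance -/

/-- The operator `G_{k,k+1} K_{k+1} G_{k+1,k+2} K_{k+2} ⋯ G_{k+d-1,k+d} K_{k+d}` applied to `φ`,
where `G_{j,j+1}` is multiplication by `g j` and `K_j ψ (x) = ∫ ψ(y) K_j(x, dy)`. -/
def propagate (g : ℕ → E → ℝ≥0) (K : ℕ → Kernel E E) (φ : E → ℝ) : ℕ → ℕ → E → ℝ
  | _, 0 => φ
  | k, d + 1 => fun x => g k x * ∫ y, propagate g K φ (k + 1) d y ∂(K (k + 1) x)

/-- `V_{k,n}(φ)`, the squared norm in `L²(μ_k)` of `G_{k,k+1} K_{k+1} ⋯ G_{n-1,n} K_n φ`. -/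
def stageVariance (μ : ℕ → Measure E) (g : ℕ → E → ℝ≥0) (K : ℕ → Kernel E E) (φ : E → ℝ)
    (k n : ℕ) : ℝ :=
  ∫ x, (propagate g K φ k (n - k) x) ^ 2 ∂(μ k)

/-- `V_n(φ) = ∑_{k=0}^n V_{k,n}(φ)`. -/
def asymptoticVariance (μ : ℕ → Measure E) (g : ℕ → E → ℝ≥0) (K : ℕ → Kernel E E) (φ : E → ℝ)
    (n : ℕ) : ℝ :=
  ∑ k ∈ Finset.range (n + 1), stageVariance μ g K φ k n

/-! ### The constants `Γ_g`, `γ_K^loc` and `A` -/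

/-- `Γ_g`, the maximum over `0 ≤ k ≤ n - 1` of the supremum norm of `g k`. -/
def maxDensity (g : ℕ → E → ℝ≥0) (n : ℕ) : ℝ :=
  ⨆ k : Fin n, ⨆ x : E, (g k x : ℝ)

/-- The operator norm of `κ - π` on `L²(π)`, where `π` stands for `f ↦ π(f)`. -/
def l2Deviation {X : Type*} [MeasurableSpace X] (κ : Kernel X X) (π : Measure X) : ℝ :=
  sSup {c | ∃ f : X → ℝ, Measurable f ∧ eLpNorm f 2 π ≤ 1 ∧
    c = (eLpNorm (fun x => ∫ y, f y ∂(κ x) - ∫ y, f y ∂π) 2 π).toReal}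

/-- The restriction of a kernel to a measurable subset `S`, as a kernel on `S`. -/
def modeKernel (κ : Kernel E E) {S : Set E} (hS : MeasurableSet S) : Kernel S S :=
  (κ.comap (Subtype.val : S → E) measurable_subtype_coe).comapRight
    (MeasurableEmbedding.subtype_coe hS)

/-- The normalised restriction `B ↦ ν(B) / ν(S)` of `ν` to `S`, as a measure on `S`. -/
def modeMeasure (ν : Measure E) (S : Set E) : Measure S :=
  (ν[|S]).comap (Subtype.val : S → E)

/-- `γ_K^loc = 1 - max ‖K_{k,r} - μ_{k,r}‖`, with operator norms on `L²(μ_{k,r})` and the maximum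
over the stages `1 ≤ k ≤ n` and the modes `r`. -/
def localGap (μ : ℕ → Measure E) (K : ℕ → Kernel E E) {m : ℕ} (F : Fin m → Set E)
    (hF : ∀ r, MeasurableSet (F r)) (n : ℕ) : ℝ :=
  1 - ⨆ k : Fin n, ⨆ r : Fin m,
    l2Deviation (modeKernel (K (k + 1)) (hF r)) (modeMeasure (μ (k + 1)) (F r))

/-- `A`, the maximum of `μ_k(F r) / μ_j(F r)` over `0 ≤ j < k ≤ n` and the modes `r`. -/
def growthWithinMode (μ : ℕ → Measure E) {m : ℕ} (F : Fin m → Set E) (n : ℕ) : ℝ :=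
  sSup {a | ∃ (j k : ℕ) (r : Fin m), j < k ∧ k ≤ n ∧ a = (μ k).real (F r) / (μ j).real (F r)}

end SMC

end

/-!
Given the particles at stage `k`, those at stage `k + 1` are i.i.d. with law `ν_N K_{k+1}`, where
`ν_N` is the weighted empirical measure. For `μ_{k+1}(f) = 0`, the rescaled error
`√N (μ_{k+1}^N - μ_{k+1})(f)` is therefore a conditionally centred sum, Gaussian in the limit with
variance `μ_{k+1}(f²)`, plus `√N ν_N(K_{k+1} f)`, which is asymptotically the error of
`G_{k,k+1} K_{k+1} f` at stage `k`. Induction on the stage yields the formula for `V_n`. Second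
moments suffice, as dominated convergence and the law of large numbers control the Lindeberg
remainder.

For the bound, fix a mode. One step costs a factor `Γ_g`; on the mode the kernel contracts the
variance by `(1 - γ_K^loc)²`, and the squared mean that remains is controlled because the mass
`∫_{F r} G K ⋯ G K φ dμ_k` does not depend on `k`. By Cauchy-Schwarz and the definition of `A`, the
stage variances thus satisfy `V_{k,n} ≤ Γ_g (1 - γ_K^loc)² V_{k+1,n} + A Γ_g μ(φ²)`.
-/

noncomputable section

namespace SMC

section CompMeasure

variable {X Y G : Type*} [MeasurableSpace X] [MeasurableSpace Y] [NormedAddCommGroup G]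
  [NormedSpace ℝ G] {μ : Measure X} {κ : Kernel X Y} {f : Y → G}

lemma integral_comp_measure (hf : Integrable f (κ ∘ₘ μ)) :
    ∫ y, f y ∂(κ ∘ₘ μ) = ∫ x, ∫ y, f y ∂(κ x) ∂μ := by
  rw [Measure.comp_eq_comp_const_apply] at hf ⊢
  rw [Kernel.integral_comp hf, Kernel.const_apply]

lemma integrable_integral_of_integrable_comp (hf : Integrable f (κ ∘ₘ μ)) :
    Integrable (fun x => ∫ y, f y ∂(κ x)) μ := by
  rw [Measure.comp_eq_comp_const_apply] at hf
  simpa only [Kernel.const_apply] using hf.integral_comp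

end CompMeasure

section InProb

variable {Ω Ω' : ℕ → Type*} [∀ N, MeasurableSpace (Ω N)] [∀ N, MeasurableSpace (Ω' N)]

/-- The filter of the sets whose complement has `P N`-probability tending to `0`. A family of
random variables `X N : Ω N → ℝ` converges in probability if and only if it converges, as a function
on the disjoint union of the `Ω N`, along this filter. -/
def inProb (P : ∀ N, Measure (Ω N)) : Filter (Σ N, Ω N) :=
  comk (fun S => Tendsto (fun N => P N (Sigma.mk N ⁻¹' S)) atTop (𝓝 0)) (by simp)
    (fun _ hT _ hST => tendsto_of_tendsto_of_tendsto_of_le_of_le tendsto_const_nhds hT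
      (fun _ => zero_le) fun _ => measure_mono (Set.preimage_mono hST))
    fun _ hS _ hT => tendsto_of_tendsto_of_tendsto_of_le_of_le tendsto_const_nhds
      (add_zero (0 : ℝ≥0∞) ▸ hS.add hT) (fun _ => zero_le) fun _ => measure_union_le _ _

variable {P : ∀ N, Measure (Ω N)}

lemma eventually_inProb {p : (Σ N, Ω N) → Prop} :
    (∀ᶠ q in inProb P, p q) ↔ Tendsto (fun N => P N {x | ¬ p ⟨N, x⟩}) atTop (𝓝 0) := Iff.rfl

lemma tendsto_fst_inProb : Tendsto Sigma.fst (inProb P) atTop := by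
  refine tendsto_atTop.2 fun b => eventually_inProb.2 (tendsto_const_nhds.congr' ?_)
  filter_upwards [eventually_ge_atTop b] with N hN
  simp [hN]

lemma tendsto_integral_of_tendsto_inProb [∀ N, IsProbabilityMeasure (P N)] {G : Type*}
    [NormedAddCommGroup G] [NormedSpace ℝ G] {F : (Σ N, Ω N) → G} {C : ℝ≥0}
    (hC : ∀ p, ‖F p‖₊ ≤ C) (hF : Tendsto F (inProb P) (𝓝 0)) :
    Tendsto (fun N => ∫ x, F ⟨N, x⟩ ∂(P N)) atTop (𝓝 0) := by
  refine tendsto_zero_iff_enorm_tendsto_zero.2 (ENNReal.tendsto_nhds_zero.2 fun ε hε => ?_)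
  set S : ∀ N, Set (Ω N) := fun N => {x | ¬ ‖F ⟨N, x⟩‖ₑ ≤ ε / 2}
  have hPS : Tendsto (fun N => C * P N (S N)) atTop (𝓝 0) := by
    have hsmall : ∀ᶠ p in inProb P, ‖F p‖ₑ ≤ ε / 2 :=
      ENNReal.tendsto_nhds_zero.1 (tendsto_zero_iff_enorm_tendsto_zero.1 hF) _
        (ENNReal.half_pos hε.ne')
    simpa only [mul_zero] using ENNReal.Tendsto.const_mul (a := C) (eventually_inProb.1 hsmall)
      (.inr ENNReal.coe_ne_top)
  filter_upwards [ENNReal.tendsto_nhds_zero.1 hPS _ (ENNReal.half_pos hε.ne')] with N hN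
  have hle : ∀ x, ‖F ⟨N, x⟩‖ₑ ≤ ε / 2 + (S N).indicator (fun _ => (C : ℝ≥0∞)) x := fun x => by
    by_cases hx : x ∈ S N
    · rw [Set.indicator_of_mem hx]
      exact le_add_of_nonneg_of_le zero_le (ENNReal.coe_le_coe.2 (hC _))
    · exact (not_not.1 hx).trans le_self_add
  calc ‖∫ x, F ⟨N, x⟩ ∂(P N)‖ₑ
      ≤ ∫⁻ x, (ε / 2 + (S N).indicator (fun _ => (C : ℝ≥0∞)) x) ∂(P N) :=
        (enorm_integral_le_lintegral_enorm _).trans (lintegral_mono hle)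
    _ ≤ ε / 2 + C * P N (S N) := by
        rw [lintegral_add_left measurable_const, lintegral_const, measure_univ, mul_one]
        gcongr
        exact lintegral_indicator_const_le _ _
    _ ≤ ε := (add_le_add_right hN _).trans_eq (ENNReal.add_halves ε)

section Kernel

variable {κ : ∀ N, Kernel (Ω N) (Ω' N)} [∀ N, IsMarkovKernel (κ N)]

lemma eventually_inProb_comp {p : (Σ N, Ω' N) → Prop}
    (hp : ∀ N, MeasurableSet {y | p ⟨N, y⟩})
    (h : ∀ᶠ q in inProb P, ∀ᵐ y ∂(κ q.1 q.2), p ⟨q.1, y⟩) :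
    ∀ᶠ q in inProb fun N => κ N ∘ₘ P N, p q := by
  rw [eventually_inProb] at h ⊢
  refine tendsto_of_tendsto_of_tendsto_of_le_of_le tendsto_const_nhds h (fun _ => zero_le)
    fun N => ?_
  have hm : Measurable fun x => κ N x {y | ¬ p ⟨N, y⟩} := (κ N).measurable_coe (hp N).compl
  have hms : MeasurableSet {x | ¬ ∀ᵐ y ∂(κ N x), p ⟨N, y⟩} :=
    (hm (measurableSet_singleton 0)).compl
  calc (κ N ∘ₘ P N) {y | ¬ p ⟨N, y⟩}
      = ∫⁻ x, κ N x {y | ¬ p ⟨N, y⟩} ∂(P N) := Measure.bind_apply (hp N).compl (κ N).aemeasurable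
    _ ≤ ∫⁻ x, {x | ¬ ∀ᵐ y ∂(κ N x), p ⟨N, y⟩}.indicator 1 x ∂(P N) := by
        refine lintegral_mono fun x => ?_
        by_cases hx : ∀ᵐ y ∂(κ N x), p ⟨N, y⟩
        · exact (ae_iff.1 hx).trans_le zero_le
        · rw [Set.indicator_of_mem (show x ∈ {x | ¬ ∀ᵐ y ∂(κ N x), p ⟨N, y⟩} from hx)]
          exact prob_le_one
    _ = P N {x | ¬ ∀ᵐ y ∂(κ N x), p ⟨N, y⟩} := lintegral_indicator_one hms

lemma tendsto_integral_comp_sub_of_tendsto_inProb [∀ N, IsProbabilityMeasure (P N)]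
    {H : ∀ N, Ω' N → ℂ} {F : ∀ N, Ω N → ℂ} (hH : ∀ N, Measurable (H N))
    (hF : ∀ N, Measurable (F N)) (hH1 : ∀ N y, ‖H N y‖ ≤ 1) (hF1 : ∀ N x, ‖F N x‖ ≤ 1)
    (h : Tendsto (fun p : Σ N, Ω N => ∫ y, H p.1 y ∂(κ p.1 p.2) - F p.1 p.2) (inProb P) (𝓝 0)) :
    Tendsto (fun N => ∫ y, H N y ∂(κ N ∘ₘ P N) - ∫ x, F N x ∂(P N)) atTop (𝓝 0) := by
  have hbound : ∀ p : Σ N, Ω N, ‖∫ y, H p.1 y ∂(κ p.1 p.2) - F p.1 p.2‖₊ ≤ 2 := fun p => by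
    have hHint : ‖∫ y, H p.1 y ∂(κ p.1 p.2)‖ ≤ 1 :=
      (norm_integral_le_of_norm_le_const (ae_of_all _ (hH1 p.1))).trans_eq (by simp)
    refine NNReal.coe_le_coe.1 ?_
    rw [coe_nnnorm, NNReal.coe_ofNat]
    linarith [norm_sub_le (∫ y, H p.1 y ∂(κ p.1 p.2)) (F p.1 p.2), hF1 p.1 p.2]
  refine (tendsto_integral_of_tendsto_inProb hbound h).congr fun N => ?_
  have hHi : Integrable (H N) (κ N ∘ₘ P N) :=
    .of_bound (hH N).aestronglyMeasurable 1 (ae_of_all _ (hH1 N))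
  have hFi : Integrable (F N) (P N) :=
    .of_bound (hF N).aestronglyMeasurable 1 (ae_of_all _ (hF1 N))
  rw [integral_comp_measure hHi]
  exact integral_sub (integrable_integral_of_integrable_comp hHi) hFi

end Kernel

section Real

variable [∀ N, IsProbabilityMeasure (P N)] {X : ∀ N, Ω N → ℝ} {ν : Measure ℝ}
  [IsProbabilityMeasure ν]

lemma tendstoInDistribution_id_iff (hX : ∀ N, Measurable (X N)) :
    TendstoInDistribution X atTop id P ν ↔ ∀ t : ℝ,
      Tendsto (fun N => ∫ x, Complex.exp ((t * X N x : ℝ) * Complex.I) ∂(P N)) atTop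
        (𝓝 (charFun ν t)) := by
  have hcharFun : ∀ t N, charFun ((P N).map (X N)) t =
      ∫ x, Complex.exp ((t * X N x : ℝ) * Complex.I) ∂(P N) := fun t N => by
    rw [charFun_apply_real, integral_map (hX N).aemeasurable (by fun_prop)]
    simp only [Complex.ofReal_mul]
  refine ⟨fun h t => ?_, fun h => ⟨fun N => (hX N).aemeasurable, aemeasurable_id, ?_⟩⟩
  · simpa [hcharFun] using ProbabilityMeasure.tendsto_iff_tendsto_charFun.1 h.tendsto t
  · exact ProbabilityMeasure.tendsto_iff_tendsto_charFun.2 fun t => by simpa [hcharFun] using h t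

lemma tendsto_inProb_of_tendstoInDistribution_dirac {c : ℝ}
    (h : TendstoInDistribution X atTop id P (Measure.dirac c)) :
    Tendsto (fun p : Σ N, Ω N => X p.1 p.2) (inProb P) (𝓝 c) := by
  refine fun U hU => eventually_inProb.2 ?_
  obtain ⟨V, hVU, hV, hcV⟩ := mem_nhds_iff.1 hU
  have hlimsup := ProbabilityMeasure.limsup_measure_closed_le_of_tendsto h.tendsto hV.isClosed_compl
  simp only [ProbabilityMeasure.coe_mk, Measure.map_id] at hlimsup
  rw [Measure.dirac_apply' _ hV.measurableSet.compl,
    Set.indicator_of_notMem (by simpa using hcV)] at hlimsup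
  have hmap := tendsto_of_le_liminf_of_limsup_le zero_le hlimsup
  refine tendsto_of_tendsto_of_tendsto_of_le_of_le tendsto_const_nhds hmap (fun _ => zero_le)
    fun N => ?_
  dsimp only
  rw [Measure.map_apply_of_aemeasurable (h.forall_aemeasurable N) hV.measurableSet.compl]
  exact measure_mono fun x hx hxV => hx (hVU hxV)

lemma tendsto_mul_inProb_of_tendstoInDistribution (h : TendstoInDistribution X atTop id P ν)
    {Y : (Σ N, Ω N) → ℝ} (hY : Tendsto Y (inProb P) (𝓝 0)) :
    Tendsto (fun p => X p.1 p.2 * Y p) (inProb P) (𝓝 0) := by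
  have (N : ℕ) := Measure.isProbabilityMeasure_map (h.forall_aemeasurable N)
  have htight : IsTightMeasureSet (Set.range fun N => (P N).map (X N)) := by
    refine isTightMeasureSet_of_tendsto_charFun (continuous_charFun (μ := ν)).continuousAt ?_
    simpa using ProbabilityMeasure.tendsto_iff_tendsto_charFun.1 h.tendsto
  rw [Metric.tendsto_nhds]
  refine fun ε hε => eventually_inProb.2 (ENNReal.tendsto_nhds_zero.2 fun δ hδ => ?_)
  obtain ⟨M, hM, hM0⟩ := ((ENNReal.tendsto_nhds_zero.1
    (tendsto_measure_norm_gt_of_isTightMeasureSet htight) (δ / 2) (ENNReal.half_pos hδ.ne')).and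
      (eventually_gt_atTop 0)).exists
  have hYε := eventually_inProb.1 (Metric.tendsto_nhds.1 hY (ε / M) (div_pos hε hM0))
  filter_upwards [ENNReal.tendsto_nhds_zero.1 hYε (δ / 2) (ENNReal.half_pos hδ.ne')] with N hN
  have hXM : P N {x | M < ‖X N x‖} ≤ δ / 2 := by
    refine le_trans ?_ ((le_iSup₂ (f := fun π (_ : π ∈ Set.range fun N => (P N).map (X N)) =>
      π {x | M < ‖x‖}) _ ⟨N, rfl⟩).trans hM)
    dsimp only
    rw [Measure.map_apply_of_aemeasurable (h.forall_aemeasurable N)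
      (measurableSet_lt measurable_const measurable_norm)]
    rfl
  calc P N {x | ¬ dist (X N x * Y ⟨N, x⟩) 0 < ε}
      ≤ P N ({x | M < ‖X N x‖} ∪ {x | ¬ dist (Y ⟨N, x⟩) 0 < ε / M}) := by
        refine measure_mono fun x hx => ?_
        by_contra hsmall
        obtain ⟨hXx, hYx⟩ := not_or.1 hsmall
        rw [Set.mem_ofPred_eq, not_lt] at hXx
        rw [Set.mem_ofPred_eq, not_not, dist_zero_right, lt_div_iff₀ hM0] at hYx
        refine hx ?_
        rw [dist_zero_right, norm_mul, mul_comm]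
        exact (mul_le_mul_of_nonneg_left hXx (norm_nonneg _)).trans_lt hYx
    _ ≤ δ / 2 + δ / 2 := (measure_union_le _ _).trans (add_le_add hXM hN)
    _ = δ := ENNReal.add_halves δ

end Real

end InProb

section ComplexExponential

lemma tendsto_one_add_pow_cexp {ι : Type*} {l : Filter ι} {n : ι → ℕ} {u : ι → ℂ} {z : ℂ}
    (hn : Tendsto n l atTop) (hu : Tendsto (fun p => n p * u p) l (𝓝 z)) :
    Tendsto (fun p => (1 + u p) ^ n p) l (𝓝 (Complex.exp z)) := by
  have hinv : Tendsto (fun p => ((n p : ℂ))⁻¹) l (𝓝 0) :=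
    tendsto_inv₀_cobounded.comp (tendsto_natCast_atTop_cobounded.comp hn)
  have hu0 : Tendsto u l (𝓝 0) := by
    refine (by simpa only [zero_mul] using hinv.mul hu :
      Tendsto (fun p => (n p : ℂ)⁻¹ * (n p * u p)) l (𝓝 0)).congr' ?_
    filter_upwards [hn.eventually_ne_atTop 0] with p hp
    exact inv_mul_cancel_left₀ (Nat.cast_ne_zero.2 hp) _
  have hlog : Tendsto (fun p => n p * (Complex.log (1 + u p) - u p)) l (𝓝 0) := by
    refine ((Asymptotics.isBigO_refl (fun p => (n p : ℂ)) l).mul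
      (Complex.log_sub_self_isBigO.comp_tendsto hu0)).trans_tendsto ?_
    simpa only [Function.comp_apply, sq, ← mul_assoc, mul_zero] using hu.mul hu0
  have hexp := (Complex.continuous_exp.tendsto _).comp (hlog.add hu)
  rw [zero_add] at hexp
  have hne : ∀ᶠ p in l, 1 + u p ≠ 0 := by
    simpa using (hu0.const_add 1).eventually_ne (by simp : (1 : ℂ) + 0 ≠ 0)
  refine hexp.congr' (hne.mono fun p hp => ?_)
  rw [Function.comp_apply, ← mul_add, sub_add_cancel, Complex.exp_nat_mul, Complex.exp_log hp]

lemma norm_cexp_mul_I_sub_linear_le (x : ℝ) :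
    ‖Complex.exp (x * Complex.I) - (1 + x * Complex.I)‖ ≤ 2 * |x| * min 1 |x| := by
  have hx : ‖(x : ℂ) * Complex.I‖ = |x| := by simp
  rw [← sub_sub]
  rcases le_total |x| 1 with h | h
  · rw [min_eq_right h]
    have hexp := Complex.norm_exp_sub_one_sub_id_le (hx.trans_le h)
    rw [hx] at hexp
    linarith [mul_self_nonneg |x|]
  · have hexp : ‖Complex.exp (x * Complex.I) - 1‖ ≤ |x| := by
      rw [mul_comm]
      exact Real.norm_exp_I_mul_ofReal_sub_one_le
    rw [min_eq_left h]
    linarith [norm_sub_le (Complex.exp (x * Complex.I) - 1) (x * Complex.I)]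

lemma norm_cexp_mul_I_sub_quadratic_le (x : ℝ) :
    ‖Complex.exp (x * Complex.I) - (1 + x * Complex.I - x ^ 2 / 2)‖ ≤
      3 * x ^ 2 * min 1 |x| := by
  rcases le_total |x| 1 with h | h
  · have hexp := Complex.exp_bound (x := x * Complex.I) (by simpa using h) (n := 3) (by norm_num)
    have htaylor : ∑ m ∈ Finset.range 3, ((x : ℂ) * Complex.I) ^ m / m.factorial =
        1 + x * Complex.I - x ^ 2 / 2 := by
      simp [Finset.sum_range_succ, mul_pow, Nat.factorial]
      ring
    rw [htaylor, norm_mul, Complex.norm_I, mul_one, Complex.norm_real, Real.norm_eq_abs] at hexp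
    norm_num [Nat.factorial] at hexp
    rw [min_eq_right h, ← sq_abs x]
    linarith [pow_nonneg (abs_nonneg x) 3, pow_succ |x| 2]
  · have hlin := norm_cexp_mul_I_sub_linear_le x
    have hsq : ‖(x : ℂ) ^ 2 / 2‖ = |x| ^ 2 / 2 := by simp
    have hle := norm_add_le (Complex.exp (x * Complex.I) - (1 + x * Complex.I)) ((x : ℂ) ^ 2 / 2)
    rw [min_eq_left h] at hlin ⊢
    rw [← sub_add, ← sq_abs x]
    nlinarith

lemma norm_cexp_mul_I_sub_cexp_mul_I_le (x y : ℝ) :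
    ‖Complex.exp (x * Complex.I) - Complex.exp (y * Complex.I)‖ ≤ |x - y| := by
  have hfactor : Complex.exp (x * Complex.I) - Complex.exp (y * Complex.I) =
      Complex.exp (y * Complex.I) * (Complex.exp (Complex.I * (x - y : ℝ)) - 1) := by
    rw [mul_sub, ← Complex.exp_add, mul_one]
    congr 2
    push_cast
    ring
  rw [hfactor, norm_mul, Complex.norm_exp_ofReal_mul_I, one_mul]
  exact Real.norm_exp_I_mul_ofReal_sub_one_le

end ComplexExponential

section CharacteristicIntegral

variable {E : Type*} [MeasurableSpace E] {ν : Measure E} {f : E → ℝ}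

lemma integrable_cexp_mul_I [IsFiniteMeasure ν] (hf : AEStronglyMeasurable f ν) :
    Integrable (fun x => Complex.exp (f x * Complex.I)) ν :=
  .of_bound ((by fun_prop : Continuous fun y : ℝ => Complex.exp (y * Complex.I))
    |>.comp_aestronglyMeasurable hf) 1 (ae_of_all _ fun x => (Complex.norm_exp_ofReal_mul_I _).le)

lemma integrable_mul_min_one {u v : E → ℝ} (hu : Integrable u ν) (hv : AEStronglyMeasurable v ν)
    (hv0 : ∀ x, 0 ≤ v x) : Integrable (fun x => u x * min 1 (v x)) ν := by
  refine hu.mul_bdd (c := 1) ((continuous_const.min continuous_id).comp_aestronglyMeasurable hv)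
    (ae_of_all _ fun x => ?_)
  rw [Real.norm_of_nonneg (le_min zero_le_one (hv0 x))]
  exact min_le_left _ _

lemma pow_integral_cexp_eq_mul_cexp (t m : ℝ) (n : ℕ) :
    (∫ x, Complex.exp ((t * ((√(n : ℝ))⁻¹ * f x) : ℝ) * Complex.I) ∂ν) ^ n =
      (∫ x, Complex.exp ((t * ((√(n : ℝ))⁻¹ * (f x - m)) : ℝ) * Complex.I) ∂ν) ^ n *
        Complex.exp ((t * (√(n : ℝ) * m) : ℝ) * Complex.I) := by
  have hsqrt : ((√(n : ℝ) : ℝ) : ℂ) = n * ((√(n : ℝ) : ℝ) : ℂ)⁻¹ := by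
    exact_mod_cast (Real.div_sqrt (x := (n : ℝ))).symm.trans (div_eq_mul_inv _ _)
  have hexp : Complex.exp ((t * (√(n : ℝ) * m) : ℝ) * Complex.I) =
      Complex.exp ((t * ((√(n : ℝ))⁻¹ * m) : ℝ) * Complex.I) ^ n := by
    rw [← Complex.exp_nat_mul]
    congr 1
    push_cast
    linear_combination (t * m * Complex.I) * hsqrt
  rw [hexp, ← mul_pow, ← integral_mul_const]
  congr 2 with x
  rw [← Complex.exp_add]
  congr 1
  push_cast
  ring

variable [IsProbabilityMeasure ν]

lemma norm_integral_cexp_sub_linear_le (hf : Integrable f ν) :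
    ‖∫ x, Complex.exp (f x * Complex.I) ∂ν - (1 + (∫ x, f x ∂ν : ℝ) * Complex.I)‖ ≤
      ∫ x, 2 * |f x| * min 1 |f x| ∂ν := by
  have hfI : Integrable (fun x => (f x : ℂ) * Complex.I) ν := hf.ofReal.mul_const _
  have hlin : Integrable (fun x => (1 : ℂ) + f x * Complex.I) ν := (integrable_const 1).add hfI
  have hint : ∫ x, Complex.exp (f x * Complex.I) ∂ν - (1 + (∫ x, f x ∂ν : ℝ) * Complex.I) =
      ∫ x, (Complex.exp (f x * Complex.I) - (1 + f x * Complex.I)) ∂ν := by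
    rw [integral_sub (integrable_cexp_mul_I hf.1) hlin,
      integral_add (integrable_const 1) hfI, integral_mul_const, integral_complex_ofReal]
    simp
  rw [hint]
  exact norm_integral_le_of_norm_le
    (integrable_mul_min_one (hf.abs.const_mul 2) hf.abs.1 fun _ => abs_nonneg _)
    (ae_of_all _ fun x => norm_cexp_mul_I_sub_linear_le (f x))

lemma norm_integral_cexp_sub_quadratic_le (hf : MemLp f 2 ν) :
    ‖∫ x, Complex.exp (f x * Complex.I) ∂ν -
        (1 + (∫ x, f x ∂ν : ℝ) * Complex.I - (∫ x, f x ^ 2 ∂ν : ℝ) / 2)‖ ≤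
      ∫ x, 3 * f x ^ 2 * min 1 |f x| ∂ν := by
  have hf1 : Integrable f ν := hf.integrable one_le_two
  have hlin : Integrable (fun x => (1 : ℂ) + f x * Complex.I) ν :=
    (integrable_const 1).add (hf1.ofReal.mul_const _)
  have hsq : Integrable (fun x => (f x : ℂ) ^ 2 / 2) ν := by
    simpa using (hf.integrable_sq.ofReal (𝕜 := ℂ)).div_const 2
  have hquad : Integrable (fun x => (1 : ℂ) + f x * Complex.I - f x ^ 2 / 2) ν := hlin.sub hsq
  have hint : ∫ x, Complex.exp (f x * Complex.I) ∂ν -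
        (1 + (∫ x, f x ∂ν : ℝ) * Complex.I - (∫ x, f x ^ 2 ∂ν : ℝ) / 2) =
      ∫ x, (Complex.exp (f x * Complex.I) - (1 + f x * Complex.I - f x ^ 2 / 2)) ∂ν := by
    rw [integral_sub (integrable_cexp_mul_I hf1.1) hquad, integral_sub hlin hsq,
      integral_add (integrable_const 1) (hf1.ofReal.mul_const _), integral_mul_const,
      integral_complex_ofReal, integral_div, ← integral_complex_ofReal (f := fun x => f x ^ 2)]
    simp
  rw [hint]
  exact norm_integral_le_of_norm_le
    (integrable_mul_min_one (hf.integrable_sq.const_mul 3) hf1.abs.1 fun _ => abs_nonneg _)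
    (ae_of_all _ fun x => norm_cexp_mul_I_sub_quadratic_le (f x))

lemma norm_mul_integral_cexp_sub_one_sub_linear_le (hf : Integrable f ν) {n : ℕ} (hn : 0 < n)
    (t : ℝ) :
    ‖n * (∫ x, Complex.exp ((t * ((n : ℝ)⁻¹ * f x) : ℝ) * Complex.I) ∂ν - 1) -
        (t * ∫ x, f x ∂ν : ℝ) * Complex.I‖ ≤
      2 * ∫ x, |t * f x| * min 1 ((n : ℝ)⁻¹ * |t * f x|) ∂ν := by
  have hn0 : (0 : ℝ) < n := Nat.cast_pos.2 hn
  have hlin := norm_integral_cexp_sub_linear_le ((hf.const_mul (n : ℝ)⁻¹).const_mul t)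
  rw [integral_const_mul, integral_const_mul] at hlin
  calc ‖n * (∫ x, Complex.exp ((t * ((n : ℝ)⁻¹ * f x) : ℝ) * Complex.I) ∂ν - 1) -
        (t * ∫ x, f x ∂ν : ℝ) * Complex.I‖
      = ‖n * (∫ x, Complex.exp ((t * ((n : ℝ)⁻¹ * f x) : ℝ) * Complex.I) ∂ν -
          (1 + (t * ((n : ℝ)⁻¹ * ∫ x, f x ∂ν) : ℝ) * Complex.I))‖ := by
        congr 1
        push_cast
        linear_combination
          t * (∫ x, f x ∂ν : ℝ) * Complex.I * mul_inv_cancel₀ (Nat.cast_ne_zero (R := ℂ).2 hn.ne')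
    _ ≤ n * ∫ x, 2 * |t * ((n : ℝ)⁻¹ * f x)| * min 1 |t * ((n : ℝ)⁻¹ * f x)| ∂ν := by
        rw [norm_mul, Complex.norm_natCast]
        exact mul_le_mul_of_nonneg_left hlin hn0.le
    _ = 2 * ∫ x, |t * f x| * min 1 ((n : ℝ)⁻¹ * |t * f x|) ∂ν := by
        rw [← integral_const_mul, ← integral_const_mul]
        refine integral_congr_ae (ae_of_all _ fun x => ?_)
        beta_reduce
        rw [mul_left_comm t, abs_mul, abs_of_pos (inv_pos.2 hn0)]
        field_simp

lemma norm_mul_integral_cexp_sub_one_add_quadratic_le (hf : MemLp f 2 ν) {n : ℕ} (hn : 0 < n)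
    (t : ℝ) :
    ‖n * (∫ x, Complex.exp ((t * ((√(n : ℝ))⁻¹ * (f x - ∫ y, f y ∂ν)) : ℝ) * Complex.I) ∂ν - 1) +
        (t ^ 2 * Var[f; ν] / 2 : ℝ)‖ ≤
      3 * t ^ 2 * ∫ x, (f x - ∫ y, f y ∂ν) ^ 2 *
        min 1 (|t| * (√(n : ℝ))⁻¹ * |f x - ∫ y, f y ∂ν|) ∂ν := by
  have hn0 : (0 : ℝ) < n := Nat.cast_pos.2 hn
  have hsq : (√(n : ℝ))⁻¹ ^ 2 = (n : ℝ)⁻¹ := by rw [inv_pow, Real.sq_sqrt hn0.le]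
  set h : E → ℝ := fun x => f x - ∫ y, f y ∂ν
  have hh : MemLp h 2 ν := hf.sub (memLp_const _)
  have hquad := norm_integral_cexp_sub_quadratic_le ((hh.const_mul (√(n : ℝ))⁻¹).const_mul t)
  have hmean : ∫ x, t * ((√(n : ℝ))⁻¹ * h x) ∂ν = 0 := by
    rw [integral_const_mul, integral_const_mul, integral_sub (hf.integrable one_le_two)
      (integrable_const _)]
    simp
  have hvar : ∫ x, (t * ((√(n : ℝ))⁻¹ * h x)) ^ 2 ∂ν = (n : ℝ)⁻¹ * (t ^ 2 * Var[f; ν]) := by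
    simp only [mul_pow, hsq, integral_const_mul, variance_eq_integral hf.aemeasurable, h]
    ring
  rw [hmean, hvar] at hquad
  calc ‖n * (∫ x, Complex.exp ((t * ((√(n : ℝ))⁻¹ * h x) : ℝ) * Complex.I) ∂ν - 1) +
        (t ^ 2 * Var[f; ν] / 2 : ℝ)‖
      = ‖n * (∫ x, Complex.exp ((t * ((√(n : ℝ))⁻¹ * h x) : ℝ) * Complex.I) ∂ν -
          (1 + (0 : ℝ) * Complex.I - ((n : ℝ)⁻¹ * (t ^ 2 * Var[f; ν]) : ℝ) / 2))‖ := by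
        congr 1
        push_cast
        linear_combination (-(t : ℂ) ^ 2 * (Var[f; ν] : ℝ) / 2) *
          mul_inv_cancel₀ (Nat.cast_ne_zero (R := ℂ).2 hn.ne')
    _ ≤ n * ∫ x, 3 * (t * ((√(n : ℝ))⁻¹ * h x)) ^ 2 * min 1 |t * ((√(n : ℝ))⁻¹ * h x)| ∂ν := by
        rw [norm_mul, Complex.norm_natCast]
        exact mul_le_mul_of_nonneg_left hquad hn0.le
    _ = 3 * t ^ 2 * ∫ x, h x ^ 2 * min 1 (|t| * (√(n : ℝ))⁻¹ * |h x|) ∂ν := by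
        rw [← integral_const_mul, ← integral_const_mul]
        refine integral_congr_ae (ae_of_all _ fun x => ?_)
        beta_reduce
        rw [abs_mul, abs_mul, abs_of_nonneg (inv_nonneg.2 (Real.sqrt_nonneg _)), mul_pow, mul_pow,
          hsq, ← mul_assoc |t|]
        field_simp

end CharacteristicIntegral

section Approximates

variable {E ι : Type*} [MeasurableSpace E]

/-- Convergence of the measures `π p` to `μ` along `l`, tested against all `μ`-integrable functions:
these need not be bounded, so their integrability is part of the definition. For random measures one
takes `l` to be a filter `inProb P`. -/
structure Approximates (l : Filter ι) (π : ι → Measure E) (μ : Measure E) : Prop where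
  isProbabilityMeasure : ∀ᶠ p in l, IsProbabilityMeasure (π p)
  ae {q : E → Prop} : MeasurableSet {x | q x} → (∀ᵐ x ∂μ, q x) → ∀ᶠ p in l, ∀ᵐ x ∂(π p), q x
  integrable {f : E → ℝ} : Measurable f → Integrable f μ → ∀ᶠ p in l, Integrable f (π p)
  tendsto_integral {f : E → ℝ} : Measurable f → Integrable f μ →
    Tendsto (fun p => ∫ x, f x ∂(π p)) l (𝓝 (∫ x, f x ∂μ))

namespace Approximates

variable {l : Filter ι} {π : ι → Measure E} {μ : Measure E} {f : E → ℝ}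

lemma const [IsProbabilityMeasure μ] : Approximates l (fun _ => μ) μ where
  isProbabilityMeasure := .of_forall fun _ => inferInstance
  ae _ h := .of_forall fun _ => h
  integrable _ h := .of_forall fun _ => h
  tendsto_integral _ _ := tendsto_const_nhds

lemma comp (h : Approximates l π μ) (K : Kernel E E) [IsMarkovKernel K] :
    Approximates l (fun p => K ∘ₘ π p) (K ∘ₘ μ) := by
  have hint : ∀ {f : E → ℝ}, Measurable f → Integrable f (K ∘ₘ μ) →
      ∀ᶠ p in l, Integrable f (K ∘ₘ π p) := fun {f} hf hfi => by
    obtain ⟨hK, hKf⟩ := (Measure.integrable_comp_iff hf.aestronglyMeasurable).1 hfi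
    filter_upwards [h.isProbabilityMeasure,
      h.ae (measurableSet_kernel_integrable (f := fun _ => f)
        (hf.comp measurable_snd).stronglyMeasurable) hK,
      h.integrable (hf.norm.stronglyMeasurable.integral_kernel (κ := K)).measurable hKf]
      with p _ hKp hKfp
    exact (Measure.integrable_comp_iff hf.aestronglyMeasurable).2 ⟨hKp, hKfp⟩
  refine ⟨?_, fun {q} hq hμ => ?_, hint, fun {f} hf hfi => ?_⟩
  · filter_upwards [h.isProbabilityMeasure] with p _ using inferInstance
  · have hqK : MeasurableSet {x | ∀ᵐ y ∂(K x), q y} :=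
      K.measurable_coe hq.compl (measurableSet_singleton 0)
    filter_upwards [h.ae hqK (Measure.ae_ae_of_ae_comp hμ)] with p hp
    exact (Measure.ae_comp_iff hq).2 hp
  · rw [integral_comp_measure hfi]
    refine (h.tendsto_integral (hf.stronglyMeasurable.integral_kernel (κ := K)).measurable
      (integrable_integral_of_integrable_comp hfi)).congr' ?_
    filter_upwards [hint hf hfi] with p hp
    exact (integral_comp_measure hp).symm

lemma memLp_two (h : Approximates l π μ) (hf : Measurable f) (hf2 : MemLp f 2 μ) :
    ∀ᶠ p in l, MemLp f 2 (π p) := by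
  filter_upwards [h.integrable (hf.pow_const 2) hf2.integrable_sq] with p hp
  exact (memLp_two_iff_integrable_sq hf.aestronglyMeasurable).2 hp

lemma tendsto_variance [IsProbabilityMeasure μ] (h : Approximates l π μ) (hf : Measurable f)
    (hf2 : MemLp f 2 μ) : Tendsto (fun p => Var[f; π p]) l (𝓝 Var[f; μ]) := by
  rw [variance_eq_sub hf2]
  refine ((h.tendsto_integral (hf.pow_const 2) hf2.integrable_sq).sub
    ((h.tendsto_integral hf (hf2.integrable one_le_two)).pow 2)).congr' ?_
  filter_upwards [h.isProbabilityMeasure, h.memLp_two hf hf2] with p _ hp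
  exact (variance_eq_sub hp).symm

lemma tendsto_integral_mul_min_one (h : Approximates l π μ) {u v : E → ℝ} (hu : Measurable u)
    (hv : Measurable v) (hu0 : ∀ x, 0 ≤ u x) (hv0 : ∀ x, 0 ≤ v x) (hui : Integrable u μ)
    {a : ι → ℝ} (ha0 : ∀ p, 0 ≤ a p) (ha : Tendsto a l (𝓝 0)) :
    Tendsto (fun p => ∫ x, u x * min 1 (a p * v x) ∂(π p)) l (𝓝 0) := by
  have hint : ∀ {ν : Measure E} {b : ℝ}, 0 ≤ b → Integrable u ν →
      Integrable (fun x => u x * min 1 (b * v x)) ν := fun hb hu =>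
    integrable_mul_min_one hu (hv.const_mul _).aestronglyMeasurable
      fun x => mul_nonneg hb (hv0 x)
  have hnonneg : ∀ {b : ℝ}, 0 ≤ b → ∀ x, 0 ≤ u x * min 1 (b * v x) := fun hb x =>
    mul_nonneg (hu0 x) (le_min zero_le_one (mul_nonneg hb (hv0 x)))
  have hdom : Tendsto (fun b => ∫ x, u x * min 1 (b * v x) ∂μ) (𝓝[>] 0)
      (𝓝 (∫ x, u x * min 1 (0 * v x) ∂μ)) := by
    refine tendsto_integral_filter_of_dominated_convergence u
      (.of_forall fun b => (hu.mul (measurable_const.min (hv.const_mul b))).aestronglyMeasurable)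
      (eventually_mem_nhdsWithin.mono fun b (hb : 0 < b) => ae_of_all _ fun x => ?_) hui
      (ae_of_all _ fun x => ?_)
    · rw [Real.norm_of_nonneg (hnonneg hb.le x)]
      exact mul_le_of_le_one_right (hu0 x) (min_le_left _ _)
    · exact ((by fun_prop : Continuous fun b => u x * min 1 (b * v x)).tendsto 0).mono_left
        nhdsWithin_le_nhds
  rw [Metric.tendsto_nhds]
  intro ε hε
  obtain ⟨b, hbε, hb⟩ :=
    ((hdom.eventually_lt_const (by simpa using hε)).and self_mem_nhdsWithin).exists
  have hbi := hint (le_of_lt hb) hui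
  have hbm : Measurable fun x => u x * min 1 (b * v x) :=
    hu.mul (measurable_const.min (hv.const_mul b))
  filter_upwards [(h.tendsto_integral hbm hbi).eventually_lt_const hbε, h.integrable hbm hbi,
    ha.eventually_lt_const hb, h.integrable hu hui] with p hp hbp hap hup
  rw [Real.dist_eq, sub_zero, abs_of_nonneg (integral_nonneg (hnonneg (ha0 p)))]
  refine (integral_mono (hint (ha0 p) hup) hbp fun x => ?_).trans_lt hp
  exact mul_le_mul_of_nonneg_left
    (min_le_min le_rfl (mul_le_mul_of_nonneg_right hap.le (hv0 x))) (hu0 x)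

variable {size : ι → ℕ}

lemma tendsto_pow_integral_cexp_mean (h : Approximates l π μ) (hs : Tendsto size l atTop)
    (hf : Measurable f) (hfi : Integrable f μ) (t : ℝ) :
    Tendsto (fun p => (∫ x, Complex.exp ((t * ((size p : ℝ)⁻¹ * f x) : ℝ) * Complex.I) ∂(π p)) ^
      size p) l (𝓝 (Complex.exp ((t * ∫ x, f x ∂μ : ℝ) * Complex.I))) := by
  set u : ι → ℂ := fun p => ∫ x, Complex.exp ((t * ((size p : ℝ)⁻¹ * f x) : ℝ) * Complex.I) ∂(π p)
  have hinv : Tendsto (fun p => (size p : ℝ)⁻¹) l (𝓝 0) :=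
    tendsto_inv_atTop_zero.comp (tendsto_natCast_atTop_atTop.comp hs)
  have hrem := (h.tendsto_integral_mul_min_one (hf.const_mul t).abs (hf.const_mul t).abs
    (fun _ => abs_nonneg _) (fun _ => abs_nonneg _) (hfi.const_mul t).abs
    (fun p => inv_nonneg.2 (Nat.cast_nonneg (size p))) hinv).const_mul 2
  rw [mul_zero] at hrem
  have hdiff : Tendsto (fun p => size p * (u p - 1) - (t * ∫ x, f x ∂(π p) : ℝ) * Complex.I) l
      (𝓝 0) := by
    refine squeeze_zero_norm' ?_ hrem
    filter_upwards [h.isProbabilityMeasure, h.integrable hf hfi, hs.eventually_gt_atTop 0]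
      with p _ hfp hn
    exact norm_mul_integral_cexp_sub_one_sub_linear_le hfp hn t
  have hcont : Continuous fun y : ℝ => ((t * y : ℝ) : ℂ) * Complex.I := by fun_prop
  have hlim := hdiff.add ((hcont.tendsto _).comp (h.tendsto_integral hf hfi))
  simp only [Function.comp_apply, sub_add_cancel, zero_add] at hlim
  simpa only [add_sub_cancel] using tendsto_one_add_pow_cexp hs hlim

lemma tendsto_integral_centered_mul_min_one [IsProbabilityMeasure μ] (h : Approximates l π μ)
    (hf : Measurable f) (hf2 : MemLp f 2 μ) {a : ι → ℝ} (ha0 : ∀ p, 0 ≤ a p)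
    (ha : Tendsto a l (𝓝 0)) :
    Tendsto (fun p => ∫ x, (f x - ∫ y, f y ∂(π p)) ^ 2 *
      min 1 (a p * |f x - ∫ y, f y ∂(π p)|) ∂(π p)) l (𝓝 0) := by
  set c : ℝ := |∫ x, f x ∂μ| + 1
  set w : E → ℝ := fun x => |f x| + c
  have hw : Measurable w := hf.abs.add_const c
  have hw0 : ∀ x, 0 ≤ w x := fun x => by positivity
  have hw2 : MemLp w 2 μ := hf2.abs.add (memLp_const c)
  have hmean : ∀ᶠ p in l, |∫ x, f x ∂(π p)| < c :=
    (h.tendsto_integral hf (hf2.integrable one_le_two)).abs.eventually_lt_const (lt_add_one _)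
  refine squeeze_zero' (.of_forall fun p => integral_nonneg fun x => ?_) ?_
    (h.tendsto_integral_mul_min_one (hw.pow_const 2) hw (fun _ => sq_nonneg _) hw0
      hw2.integrable_sq ha0 ha)
  · exact mul_nonneg (sq_nonneg _) (le_min zero_le_one (mul_nonneg (ha0 p) (abs_nonneg _)))
  filter_upwards [h.isProbabilityMeasure, h.memLp_two hw hw2, hmean] with p _ hwp hp
  have hle : ∀ x, |f x - ∫ y, f y ∂(π p)| ≤ w x := fun x => by
    linarith [abs_sub (f x) (∫ y, f y ∂(π p))]
  refine integral_mono_of_nonneg (ae_of_all _ fun x => ?_) (integrable_mul_min_one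
    hwp.integrable_sq (hw.const_mul _).aestronglyMeasurable fun x => mul_nonneg (ha0 p) (hw0 x))
    (ae_of_all _ fun x => ?_)
  · exact mul_nonneg (sq_nonneg _) (le_min zero_le_one (mul_nonneg (ha0 p) (abs_nonneg _)))
  · refine mul_le_mul (sq_le_sq.2 ((hle x).trans_eq (abs_of_nonneg (hw0 x)).symm))
      (min_le_min le_rfl (mul_le_mul_of_nonneg_left (hle x) (ha0 p)))
      (le_min zero_le_one (mul_nonneg (ha0 p) (abs_nonneg _))) (sq_nonneg _)

lemma tendsto_pow_integral_cexp_centered [IsProbabilityMeasure μ] (h : Approximates l π μ)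
    (hs : Tendsto size l atTop) (hf : Measurable f) (hf2 : MemLp f 2 μ) (t : ℝ) :
    Tendsto (fun p => (∫ x, Complex.exp ((t * ((√(size p : ℝ))⁻¹ * (f x - ∫ y, f y ∂(π p))) : ℝ) *
      Complex.I) ∂(π p)) ^ size p) l (𝓝 (Complex.exp (-(t ^ 2 * Var[f; μ] / 2) : ℝ))) := by
  set u : ι → ℂ := fun p => ∫ x, Complex.exp ((t * ((√(size p : ℝ))⁻¹ *
    (f x - ∫ y, f y ∂(π p))) : ℝ) * Complex.I) ∂(π p)
  have hsqrt : Tendsto (fun p => √(size p : ℝ)) l atTop :=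
    Real.tendsto_sqrt_atTop.comp (tendsto_natCast_atTop_atTop.comp hs)
  have hinv : Tendsto (fun p => |t| * (√(size p : ℝ))⁻¹) l (𝓝 0) := by
    simpa only [mul_zero, Function.comp_def] using
      (tendsto_inv_atTop_zero.comp hsqrt).const_mul |t|
  have hrem := (h.tendsto_integral_centered_mul_min_one hf hf2
    (fun p => mul_nonneg (abs_nonneg t) (inv_nonneg.2 (Real.sqrt_nonneg (size p)))) hinv).const_mul
      (3 * t ^ 2)
  rw [mul_zero] at hrem
  have hdiff : Tendsto (fun p => size p * (u p - 1) + (t ^ 2 * Var[f; π p] / 2 : ℝ)) l (𝓝 0) := by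
    refine squeeze_zero_norm' ?_ hrem
    filter_upwards [h.isProbabilityMeasure, h.memLp_two hf hf2, hs.eventually_gt_atTop 0]
      with p _ hfp hn
    exact norm_mul_integral_cexp_sub_one_add_quadratic_le hfp hn t
  have hvar : Tendsto (fun p => -((t ^ 2 * Var[f; π p] / 2 : ℝ) : ℂ)) l
      (𝓝 (-((t ^ 2 * Var[f; μ] / 2 : ℝ) : ℂ))) :=
    ((Complex.continuous_ofReal.tendsto _).comp
      (((h.tendsto_variance hf hf2).const_mul (t ^ 2)).div_const 2)).neg
  have hlim := hdiff.add hvar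
  simp only [add_neg_cancel_right, zero_add] at hlim
  simpa only [add_sub_cancel, Complex.ofReal_neg] using tendsto_one_add_pow_cexp hs hlim

end Approximates

end Approximates

section ConditionallyIID

variable {E : Type*}

/-- The mean of `f` under the empirical measure of the particles `p.2`. -/
def empMean (f : E → ℝ) (p : Σ N, Fin N → E) : ℝ := (p.1 : ℝ)⁻¹ * ∑ i, f (p.2 i)

lemma prod_cexp_mul_eq_cexp_empMean (f : E → ℝ) (t : ℝ) {N : ℕ} (x : Fin N → E) :
    ∏ i, Complex.exp ((t * ((N : ℝ)⁻¹ * f (x i)) : ℝ) * Complex.I) =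
      Complex.exp ((t * empMean f ⟨N, x⟩ : ℝ) * Complex.I) := by
  rw [← Complex.exp_sum, ← Finset.sum_mul, ← Complex.ofReal_sum, ← Finset.mul_sum,
    ← Finset.mul_sum, empMean]

lemma prod_cexp_mul_eq_cexp_sqrt_mul_empMean (f : E → ℝ) (t : ℝ) {N : ℕ} (x : Fin N → E) :
    ∏ i, Complex.exp ((t * ((√(N : ℝ))⁻¹ * f (x i)) : ℝ) * Complex.I) =
      Complex.exp ((t * (√(N : ℝ) * empMean f ⟨N, x⟩) : ℝ) * Complex.I) := by
  rw [← Complex.exp_sum, ← Finset.sum_mul, ← Complex.ofReal_sum, ← Finset.mul_sum,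
    ← Finset.mul_sum, empMean, ← mul_assoc (√(N : ℝ)), ← div_eq_mul_inv, Real.sqrt_div_self]

variable [MeasurableSpace E]

@[fun_prop]
lemma measurable_empMean {f : E → ℝ} (hf : Measurable f) (N : ℕ) :
    Measurable fun x : Fin N → E => empMean f ⟨N, x⟩ := by
  have hsum : Measurable fun x : Fin N → E => ∑ i, f (x i) :=
    Finset.measurable_sum _ fun i _ => hf.comp (measurable_pi_apply i)
  exact hsum.const_mul (N : ℝ)⁻¹

variable {Ω : ℕ → Type*} [∀ N, MeasurableSpace (Ω N)]

/-- Given a point drawn from `P N`, and outside an event of vanishing probability, `κ N` samples `N`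
independent particles with a common law, given by `π`, and this random law converges to `μ`. -/
structure IsConditionallyIID (P : ∀ N, Measure (Ω N)) (κ : ∀ N, Kernel (Ω N) (Fin N → E))
    (π : (Σ N, Ω N) → Measure E) (μ : Measure E) : Prop where
  eq_pi : ∀ᶠ p in inProb P, κ p.1 p.2 = Measure.pi fun _ => π p
  approximates : Approximates (inProb P) π μ

namespace IsConditionallyIID

variable {P : ∀ N, Measure (Ω N)} {κ : ∀ N, Kernel (Ω N) (Fin N → E)}
  {π : (Σ N, Ω N) → Measure E} {μ : Measure E}

lemma eventually_integral_prod_eq_pow (h : IsConditionallyIID P κ π μ) (H : ℕ → E → ℂ) :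
    ∀ᶠ p in inProb P, ∫ y, ∏ i, H p.1 (y i) ∂(κ p.1 p.2) = (∫ x, H p.1 x ∂(π p)) ^ p.1 := by
  filter_upwards [h.eq_pi, h.approximates.isProbabilityMeasure] with p hp _
  rw [hp, integral_fintype_prod_eq_pow, Fintype.card_fin]

lemma tendsto_integral_cexp_sqrt_mul_empMean_sub [IsProbabilityMeasure μ]
    (h : IsConditionallyIID P κ π μ) {f : E → ℝ} (hf : Measurable f)
    (hf2 : MemLp f 2 μ) {S : ∀ N, Ω N → ℝ}
    (hS : Tendsto (fun p => √(p.1 : ℝ) * ∫ x, f x ∂(π p) - S p.1 p.2) (inProb P) (𝓝 0)) (t : ℝ) :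
    Tendsto (fun p : Σ N, Ω N => ∫ y, Complex.exp ((t * (√(p.1 : ℝ) * empMean f ⟨p.1, y⟩) : ℝ) *
      Complex.I) ∂(κ p.1 p.2) - Complex.exp (-(t ^ 2 * Var[f; μ] / 2) : ℝ) *
        Complex.exp ((t * S p.1 p.2 : ℝ) * Complex.I)) (inProb P) (𝓝 0) := by
  set c : ℂ := Complex.exp (-(t ^ 2 * Var[f; μ] / 2) : ℝ)
  set m : (Σ N, Ω N) → ℝ := fun p => ∫ x, f x ∂(π p)
  set A : (Σ N, Ω N) → ℂ := fun p =>
    (∫ x, Complex.exp ((t * ((√(p.1 : ℝ))⁻¹ * (f x - m p)) : ℝ) * Complex.I) ∂(π p)) ^ p.1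
  have hA : Tendsto (fun p => ‖A p - c‖ + ‖c‖ * |t * (√(p.1 : ℝ) * m p - S p.1 p.2)|)
      (inProb P) (𝓝 0) := by
    simpa only [norm_zero, mul_zero, abs_zero, add_zero] using
      (tendsto_sub_nhds_zero_iff.2 (h.approximates.tendsto_pow_integral_cexp_centered
        tendsto_fst_inProb hf hf2 t)).norm.add ((hS.const_mul t).abs.const_mul ‖c‖)
  refine squeeze_zero_norm' ?_ hA
  filter_upwards [h.eventually_integral_prod_eq_pow
    fun N x => Complex.exp ((t * ((√(N : ℝ))⁻¹ * f x) : ℝ) * Complex.I)] with p hp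
  simp only [prod_cexp_mul_eq_cexp_sqrt_mul_empMean] at hp
  rw [hp, pow_integral_cexp_eq_mul_cexp _ (m p)]
  set e : ℂ := Complex.exp ((t * (√(p.1 : ℝ) * m p) : ℝ) * Complex.I)
  set s : ℂ := Complex.exp ((t * S p.1 p.2 : ℝ) * Complex.I)
  have he : ‖e‖ = 1 := Complex.norm_exp_ofReal_mul_I _
  have hes : ‖e - s‖ ≤ |t * (√(p.1 : ℝ) * m p - S p.1 p.2)| := by
    rw [mul_sub]
    exact norm_cexp_mul_I_sub_cexp_mul_I_le _ _
  calc ‖A p * e - c * s‖ = ‖(A p - c) * e + c * (e - s)‖ := by ring_nf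
    _ ≤ ‖A p - c‖ * ‖e‖ + ‖c‖ * ‖e - s‖ :=
        (norm_add_le _ _).trans_eq (by rw [norm_mul, norm_mul])
    _ ≤ _ := by
        rw [he, mul_one]
        gcongr

variable [∀ N, IsMarkovKernel (κ N)]

lemma eventually_forall (h : IsConditionallyIID P κ π μ) {q : E → Prop}
    (hq : MeasurableSet {x | q x}) (hμ : ∀ᵐ x ∂μ, q x) :
    ∀ᶠ p in inProb fun N => κ N ∘ₘ P N, ∀ i, q (p.2 i) := by
  refine eventually_inProb_comp (fun N => ?_) ?_
  · simp only [Set.ofPred_forall]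
    exact .iInter fun i => measurable_pi_apply i hq
  filter_upwards [h.eq_pi, h.approximates.isProbabilityMeasure, h.approximates.ae hq hμ]
    with p hp _ hπ
  rw [hp]
  exact ae_all_iff.2 fun i => (measurePreserving_eval (fun _ => π p) i).quasiMeasurePreserving.ae hπ

variable [∀ N, IsProbabilityMeasure (P N)] {f : E → ℝ}

lemma tendsto_empMean (h : IsConditionallyIID P κ π μ) (hf : Measurable f) (hfi : Integrable f μ) :
    Tendsto (empMean f) (inProb fun N => κ N ∘ₘ P N) (𝓝 (∫ x, f x ∂μ)) := by
  suffices hlaw : TendstoInDistribution (fun N x => empMean f ⟨N, x⟩) atTop id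
      (fun N => κ N ∘ₘ P N) (Measure.dirac (∫ x, f x ∂μ)) from
    tendsto_inProb_of_tendstoInDistribution_dirac (X := fun N x => empMean f ⟨N, x⟩) hlaw
  refine (tendstoInDistribution_id_iff (measurable_empMean hf)).2 fun t => ?_
  set z : ℂ := Complex.exp ((t * ∫ x, f x ∂μ : ℝ) * Complex.I)
  have hz : charFun (Measure.dirac (∫ x, f x ∂μ)) t = z := by
    rw [charFun_dirac]
    simp [z, mul_comm]
  have hcond : Tendsto (fun p : Σ N, Ω N => ∫ y, Complex.exp ((t * empMean f ⟨p.1, y⟩ : ℝ) *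
      Complex.I) ∂(κ p.1 p.2) - z) (inProb P) (𝓝 0) := by
    refine (tendsto_sub_nhds_zero_iff.2 (h.approximates.tendsto_pow_integral_cexp_mean
      tendsto_fst_inProb hf hfi t)).congr' ?_
    filter_upwards [h.eventually_integral_prod_eq_pow
      fun N x => Complex.exp ((t * ((N : ℝ)⁻¹ * f x) : ℝ) * Complex.I)] with p hp
    simp only [prod_cexp_mul_eq_cexp_empMean] at hp
    rw [hp]
  have hlim := tendsto_integral_comp_sub_of_tendsto_inProb
    (H := fun N x => Complex.exp ((t * empMean f ⟨N, x⟩ : ℝ) * Complex.I)) (F := fun _ _ => z)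
    (fun N => by fun_prop) (fun _ => measurable_const)
    (fun _ _ => (Complex.norm_exp_ofReal_mul_I _).le)
    (fun _ _ => (Complex.norm_exp_ofReal_mul_I _).le) hcond
  simp only [integral_const, probReal_univ, one_smul] at hlim
  rw [hz]
  exact tendsto_sub_nhds_zero_iff.1 hlim

lemma tendstoInDistribution_sqrt_mul_empMean [IsProbabilityMeasure μ]
    (h : IsConditionallyIID P κ π μ) (hf : Measurable f) (hf2 : MemLp f 2 μ)
    {S : ∀ N, Ω N → ℝ} {v : ℝ≥0}
    (hS : TendstoInDistribution S atTop id P (gaussianReal 0 v)) (hSm : ∀ N, Measurable (S N))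
    (hπS : Tendsto (fun p => √(p.1 : ℝ) * ∫ x, f x ∂(π p) - S p.1 p.2) (inProb P) (𝓝 0)) :
    TendstoInDistribution (fun (N : ℕ) x => √(N : ℝ) * empMean f ⟨N, x⟩) atTop id
      (fun N => κ N ∘ₘ P N) (gaussianReal 0 (Var[f; μ].toNNReal + v)) := by
  refine (tendstoInDistribution_id_iff fun N => (measurable_empMean hf N).const_mul _).2
    fun t => ?_
  set c : ℂ := Complex.exp (-(t ^ 2 * Var[f; μ] / 2) : ℝ)
  have hc : ‖c‖ ≤ 1 := by
    rw [Complex.norm_exp_ofReal, Real.exp_le_one_iff, neg_nonpos]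
    have := variance_nonneg f μ
    positivity
  have hlim := tendsto_integral_comp_sub_of_tendsto_inProb
    (H := fun N x => Complex.exp ((t * (√(N : ℝ) * empMean f ⟨N, x⟩) : ℝ) * Complex.I))
    (F := fun N x => c * Complex.exp ((t * S N x : ℝ) * Complex.I))
    (fun N => by fun_prop) (fun N => by fun_prop)
    (fun _ _ => (Complex.norm_exp_ofReal_mul_I _).le)
    (fun _ _ => by rwa [norm_mul, Complex.norm_exp_ofReal_mul_I, mul_one])
    (h.tendsto_integral_cexp_sqrt_mul_empMean_sub hf hf2 hπS t)
  have hlimS := ((tendstoInDistribution_id_iff hSm).1 hS t).const_mul c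
  have hchar : c * charFun (gaussianReal 0 v) t =
      charFun (gaussianReal 0 (Var[f; μ].toNNReal + v)) t := by
    simp only [charFun_gaussianReal, c]
    rw [← Complex.exp_add]
    congr 1
    push_cast
    rw [Real.coe_toNNReal _ (variance_nonneg f μ)]
    ring
  rw [← hchar]
  simpa only [integral_const_mul, sub_add_cancel, zero_add] using hlim.add hlimS

end IsConditionallyIID

end ConditionallyIID

section Transition

variable {E : Type*} [MeasurableSpace E]

/-- The empirical measure of the particles `p.2`, reweighted with `w` and normalised. -/
def weightedEmpirical (w : E → ℝ≥0) (p : Σ N, Fin N → E) : Measure E :=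
  ∑ j, (w (p.2 j) / ∑ l, w (p.2 l)) • Measure.dirac (p.2 j)

variable {w : E → ℝ≥0} {p : Σ N, Fin N → E}

lemma isProbabilityMeasure_weightedEmpirical (hp : ∑ l, w (p.2 l) ≠ 0) :
    IsProbabilityMeasure (weightedEmpirical w p) := by
  refine ⟨?_⟩
  simp only [weightedEmpirical, Measure.coe_finsetSum, Finset.sum_apply, Measure.smul_apply,
    measure_univ, ENNReal.smul_def, smul_eq_mul, mul_one]
  rw [← ENNReal.ofNNReal_finsetSum, ← Finset.sum_div, div_self hp, ENNReal.coe_one]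

lemma ae_weightedEmpirical {q : E → Prop} (hq : MeasurableSet {x | q x})
    (hp : ∀ i, w (p.2 i) ≠ 0 → q (p.2 i)) : ∀ᵐ x ∂(weightedEmpirical w p), q x := by
  refine ae_iff.2 ?_
  simp only [weightedEmpirical, Measure.coe_finsetSum, Finset.sum_apply, Measure.smul_apply]
  refine Finset.sum_eq_zero fun i _ => ?_
  rcases eq_or_ne (w (p.2 i)) 0 with hi | hi
  · rw [hi, zero_div, zero_smul]
  · rw [ae_iff.1 ((ae_dirac_iff hq).2 (hp i hi)), smul_zero]

lemma integrable_smul_dirac {f : E → ℝ} (hf : Measurable f) (c : ℝ≥0) (x : E) :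
    Integrable f (c • Measure.dirac x) :=
  (integrable_dirac' hf.stronglyMeasurable (by simp)).smul_measure_nnreal

lemma integrable_weightedEmpirical {f : E → ℝ} (hf : Measurable f) :
    Integrable f (weightedEmpirical w p) :=
  integrable_finsetSum_measure.2 fun _ _ => integrable_smul_dirac hf _ _

lemma integral_weightedEmpirical {f : E → ℝ} (hf : Measurable f) :
    ∫ x, f x ∂(weightedEmpirical w p) =
      empMean (fun x => w x * f x) p / empMean (fun x => (w x : ℝ)) p := by
  rw [weightedEmpirical, integral_finsetSum_measure fun _ _ => integrable_smul_dirac hf _ _,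
    empMean, empMean]
  simp only [integral_smul_nnreal_measure, integral_dirac' _ _ hf.stronglyMeasurable,
    NNReal.smul_def, smul_eq_mul, NNReal.coe_div, NNReal.coe_sum, div_mul_eq_mul_div]
  rw [← Finset.sum_div]
  rcases Nat.eq_zero_or_pos p.1 with h0 | h0
  · have : IsEmpty (Fin p.1) := by rw [h0]; infer_instance
    simp only [Finset.univ_eq_empty, Finset.sum_empty, mul_zero, zero_div]
  · exact (mul_div_mul_left _ _ (inv_ne_zero (Nat.cast_ne_zero.2 h0.ne'))).symm

variable {K : Kernel E E} [IsMarkovKernel K] {N : ℕ}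

lemma productKernel_comp_pi (ν : Fin N → Measure E) [∀ i, IsProbabilityMeasure (ν i)] :
    productKernel (fun i : Fin N => K.comap (fun x => x i) (measurable_pi_apply i)) ∘ₘ
      Measure.pi ν = Measure.pi fun i => K ∘ₘ ν i := by
  refine (Measure.pi_eq fun s hs => ?_).symm
  have hm : ∀ i, Measurable fun x => K x (s i) := fun i => K.measurable_coe (hs i)
  have hind := iIndepFun_pi (μ := ν) (X := fun i x => K x (s i)) fun i => (hm i).aemeasurable
  calc (productKernel (fun i : Fin N => K.comap (fun x => x i) (measurable_pi_apply i)) ∘ₘ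
        Measure.pi ν) (Set.univ.pi s)
      = ∫⁻ x, ∏ i, K (x i) (s i) ∂(Measure.pi ν) := by
        rw [Measure.bind_apply (.univ_pi hs) (Kernel.aemeasurable _)]
        exact lintegral_congr fun x => Measure.pi_pi _ _
    _ = ∏ i, ∫⁻ x, K (x i) (s i) ∂(Measure.pi ν) :=
        lintegral_prod_eq_prod_lintegral_of_indepFun _ _ hind
          fun i => (hm i).comp (measurable_pi_apply i)
    _ = ∏ i, (K ∘ₘ ν i) (s i) := Finset.prod_congr rfl fun i _ => by
        rw [Measure.bind_apply (hs i) K.aemeasurable]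
        exact (measurePreserving_eval ν i).lintegral_comp (hm i)

variable (K) in
/-- The transition of the particle system from one stage to the next: resample with weights `w`,
then move with `K`. -/
def transitionKernel (hw : Measurable w) (N : ℕ) : Kernel (Fin N → E) (Fin N → E) :=
  productKernel (fun i : Fin N => K.comap (fun x => x i) (measurable_pi_apply i)) ∘ₖ
    productKernel fun i => resampleKernel N w hw i

instance (hw : Measurable w) : IsMarkovKernel (transitionKernel K hw N) := by
  unfold transitionKernel
  infer_instance

lemma transitionKernel_apply_eq_pi (hw : Measurable w) {x : Fin N → E}
    (hx : ∑ l, w (x l) ≠ 0) :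
    transitionKernel K hw N x = Measure.pi fun _ => K ∘ₘ weightedEmpirical w ⟨N, x⟩ := by
  have : IsProbabilityMeasure (weightedEmpirical w ⟨N, x⟩) :=
    isProbabilityMeasure_weightedEmpirical hx
  have hresample : productKernel (fun i => resampleKernel N w hw i) x =
      Measure.pi fun _ => weightedEmpirical w ⟨N, x⟩ :=
    congrArg Measure.pi (funext fun _ => if_neg hx)
  rw [transitionKernel, Kernel.comp_apply, hresample, productKernel_comp_pi]

end Transition

section LimitTheorems

variable {E : Type*} [MeasurableSpace E]

/-- The law of large numbers, and the central limit theorem with asymptotic variances `V`, for the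
empirical measures of systems of `N` particles with law `P N`; moreover, with probability tending
to `1`, the particles avoid a given null set of the limit `μ`. -/
structure ObeysLimitTheorems (P : ∀ N, Measure (Fin N → E)) [∀ N, IsProbabilityMeasure (P N)]
    (μ : Measure E) (V : (E → ℝ) → ℝ≥0) : Prop where
  eventually_forall {q : E → Prop} : MeasurableSet {x | q x} → (∀ᵐ x ∂μ, q x) →
    ∀ᶠ p in inProb P, ∀ i, q (p.2 i)
  tendsto_empMean {f : E → ℝ} : Measurable f → Integrable f μ →
    Tendsto (empMean f) (inProb P) (𝓝 (∫ x, f x ∂μ))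
  tendstoInDistribution {f : E → ℝ} : Measurable f → MemLp f 2 μ → ∫ x, f x ∂μ = 0 →
    TendstoInDistribution (fun (N : ℕ) x => √(N : ℝ) * empMean f ⟨N, x⟩) atTop id P
      (gaussianReal 0 (V f))

lemma obeysLimitTheorems_pi (μ : Measure E) [IsProbabilityMeasure μ] :
    ObeysLimitTheorems (fun N => Measure.pi fun _ : Fin N => μ) μ
      fun f => (∫ x, f x ^ 2 ∂μ).toNNReal := by
  have hiid : IsConditionallyIID (fun _ => Measure.dirac ())
      (fun N => Kernel.const Unit (Measure.pi fun _ : Fin N => μ)) (fun _ => μ) μ :=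
    ⟨.of_forall fun _ => rfl, .const⟩
  have hlaw : (fun N => Measure.pi fun _ : Fin N => μ) =
      fun N => Kernel.const Unit (Measure.pi fun _ : Fin N => μ) ∘ₘ Measure.dirac () := by
    funext N
    rw [Measure.const_comp, measure_univ, one_smul]
  have hzero : TendstoInDistribution (fun (_ : ℕ) (_ : Unit) => (0 : ℝ)) atTop id
      (fun _ => Measure.dirac ()) (gaussianReal 0 0) :=
    (tendstoInDistribution_id_iff fun _ => measurable_const).2 fun t => by simp
  simp only [hlaw]
  refine ⟨hiid.eventually_forall, hiid.tendsto_empMean, fun {f} hf hf2 hf0 => ?_⟩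
  have hclt := hiid.tendstoInDistribution_sqrt_mul_empMean hf hf2 hzero
    (fun _ => measurable_const) (by simp only [hf0, mul_zero, sub_zero, tendsto_const_nhds])
  rwa [add_zero, variance_of_integral_eq_zero hf.aemeasurable hf0] at hclt

end LimitTheorems

section SquareIntegrable

variable {X Y : Type*} [MeasurableSpace X] [MeasurableSpace Y] {ν : Measure X}

lemma sq_integral_le_integral_sq [IsProbabilityMeasure ν] {f : X → ℝ} (hf : MemLp f 2 ν) :
    (∫ x, f x ∂ν) ^ 2 ≤ ∫ x, f x ^ 2 ∂ν :=
  sub_nonneg.1 ((variance_nonneg f ν).trans_eq (variance_eq_sub hf))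

lemma variance_le_integral_sq [IsProbabilityMeasure ν] {f : X → ℝ} (hf : MemLp f 2 ν) :
    Var[f; ν] ≤ ∫ x, f x ^ 2 ∂ν :=
  (variance_eq_sub hf).trans_le (sub_le_self _ (sq_nonneg _))

variable {κ : Kernel X Y} [IsMarkovKernel κ] {f : Y → ℝ}

lemma ae_sq_integral_kernel_le (hf : Measurable f) (hf2 : MemLp f 2 (κ ∘ₘ ν)) :
    ∀ᵐ x ∂ν, (∫ y, f y ∂(κ x)) ^ 2 ≤ ∫ y, f y ^ 2 ∂(κ x) := by
  filter_upwards [((Measure.integrable_comp_iff (hf.pow_const 2).aestronglyMeasurable).1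
    hf2.integrable_sq).1] with x hx
  exact sq_integral_le_integral_sq ((memLp_two_iff_integrable_sq hf.aestronglyMeasurable).2 hx)

lemma memLp_two_integral_kernel (hf : Measurable f) (hf2 : MemLp f 2 (κ ∘ₘ ν)) :
    MemLp (fun x => ∫ y, f y ∂(κ x)) 2 ν := by
  have hm : Measurable fun x => ∫ y, f y ∂(κ x) :=
    (hf.stronglyMeasurable.integral_kernel (κ := κ)).measurable
  refine (memLp_two_iff_integrable_sq hm.aestronglyMeasurable).2
    ((integrable_integral_of_integrable_comp hf2.integrable_sq).mono'
      (hm.pow_const 2).aestronglyMeasurable ?_)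
  filter_upwards [ae_sq_integral_kernel_le hf hf2] with x hx
  rwa [Real.norm_of_nonneg (sq_nonneg _)]

lemma integral_sq_integral_kernel_le (hf : Measurable f) (hf2 : MemLp f 2 (κ ∘ₘ ν)) :
    ∫ x, (∫ y, f y ∂(κ x)) ^ 2 ∂ν ≤ ∫ y, f y ^ 2 ∂(κ ∘ₘ ν) := by
  rw [integral_comp_measure hf2.integrable_sq]
  exact integral_mono_ae (memLp_two_integral_kernel hf hf2).integrable_sq
    (integrable_integral_of_integrable_comp hf2.integrable_sq) (ae_sq_integral_kernel_le hf hf2)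

end SquareIntegrable

section Step

variable {E : Type*} [MeasurableSpace E]

/-- The operator `f ↦ w · K f`, which is `G_{k,k+1} K_{k+1}` for `w = g k` and the kernel
`K (k + 1)`. -/
def stepOperator (w : E → ℝ≥0) (K : Kernel E E) (f : E → ℝ) (x : E) : ℝ := w x * ∫ y, f y ∂(K x)

/-- The passage from one stage to the next: `ν` has density `w` with respect to `μ`, with
`w ≤ C`, and the kernel `K` leaves `ν` invariant. -/
structure IsStep (C : ℝ) (w : E → ℝ≥0) (K : Kernel E E) (μ ν : Measure E) : Prop where
  measurable : Measurable w
  le_bound : ∀ x, (w x : ℝ) ≤ C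
  eq_withDensity : ν = μ.withDensity fun x => (w x : ℝ≥0∞)
  invariant : Kernel.Invariant K ν

lemma measurable_stepOperator {w : E → ℝ≥0} {K : Kernel E E} {f : E → ℝ} (hw : Measurable w)
    (hf : Measurable f) : Measurable (stepOperator w K f) :=
  hw.coe_nnreal_real.mul (hf.stronglyMeasurable.integral_kernel (κ := K)).measurable

namespace IsStep

variable {C : ℝ} {w : E → ℝ≥0} {K : Kernel E E} {μ ν : Measure E} {f : E → ℝ}

lemma integrable_iff (h : IsStep C w K μ ν) :
    Integrable f ν ↔ Integrable (fun x => w x * f x) μ := by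
  rw [h.eq_withDensity, integrable_withDensity_iff_integrable_smul h.measurable]
  simp only [NNReal.smul_def, smul_eq_mul]

lemma integral_eq (h : IsStep C w K μ ν) (f : E → ℝ) :
    ∫ x, f x ∂ν = ∫ x, w x * f x ∂μ := by
  rw [h.eq_withDensity, integral_withDensity_eq_integral_smul h.measurable]
  simp only [NNReal.smul_def, smul_eq_mul]

lemma ae_iff (h : IsStep C w K μ ν) {q : E → Prop} :
    (∀ᵐ x ∂ν, q x) ↔ ∀ᵐ x ∂μ, w x ≠ 0 → q x := by
  rw [h.eq_withDensity, ae_withDensity_iff (by have := h.measurable; fun_prop)]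
  simp only [ne_eq, ENNReal.coe_eq_zero]

lemma one_le_bound [IsProbabilityMeasure μ] [IsProbabilityMeasure ν] (h : IsStep C w K μ ν) :
    1 ≤ C := by
  have hint := h.integrable_iff.1 (integrable_const (1 : ℝ))
  have hmass := h.integral_eq fun _ => 1
  simp only [mul_one, integral_const, probReal_univ, smul_eq_mul] at hint hmass
  calc 1 = ∫ x, (w x : ℝ) ∂μ := hmass
    _ ≤ ∫ _, C ∂μ := integral_mono hint (integrable_const C) h.le_bound
    _ = C := by simp only [integral_const, probReal_univ, one_smul]

lemma sq_stepOperator_le (h : IsStep C w K μ ν) (f : E → ℝ) (x : E) :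
    stepOperator w K f x ^ 2 ≤ C * (w x * (∫ y, f y ∂(K x)) ^ 2) := by
  rw [stepOperator, mul_pow, sq (w x : ℝ), mul_assoc]
  have := h.le_bound x
  gcongr

lemma integral_stepOperator (h : IsStep C w K μ ν) (hf : Integrable f ν) :
    ∫ x, stepOperator w K f x ∂μ = ∫ x, f x ∂ν := by
  have hfK : Integrable f (K ∘ₘ ν) := by rwa [h.invariant.def]
  calc ∫ x, stepOperator w K f x ∂μ = ∫ x, ∫ y, f y ∂(K x) ∂ν := (h.integral_eq _).symm
    _ = ∫ x, f x ∂ν := by rw [← integral_comp_measure hfK, h.invariant.def]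

variable [IsMarkovKernel K]

lemma memLp_two_integral (h : IsStep C w K μ ν) (hf : Measurable f) (hf2 : MemLp f 2 ν) :
    MemLp (fun x => ∫ y, f y ∂(K x)) 2 ν :=
  memLp_two_integral_kernel hf (by rwa [h.invariant.def])

lemma memLp_two_stepOperator (h : IsStep C w K μ ν) (hf : Measurable f) (hf2 : MemLp f 2 ν) :
    MemLp (stepOperator w K f) 2 μ := by
  have hm := measurable_stepOperator (K := K) h.measurable hf
  refine (memLp_two_iff_integrable_sq hm.aestronglyMeasurable).2
    (((h.integrable_iff.1 (h.memLp_two_integral hf hf2).integrable_sq).const_mul C).mono'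
      (hm.pow_const 2).aestronglyMeasurable (ae_of_all _ fun x => ?_))
  rw [Real.norm_of_nonneg (sq_nonneg _)]
  exact h.sq_stepOperator_le f x

lemma integral_sq_stepOperator_le (h : IsStep C w K μ ν) (hf : Measurable f)
    (hf2 : MemLp f 2 ν) :
    ∫ x, stepOperator w K f x ^ 2 ∂μ ≤ C * ∫ x, (∫ y, f y ∂(K x)) ^ 2 ∂ν := by
  rw [h.integral_eq, ← integral_const_mul]
  exact integral_mono (h.memLp_two_stepOperator hf hf2).integrable_sq
    ((h.integrable_iff.1 (h.memLp_two_integral hf hf2).integrable_sq).const_mul C)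
    (h.sq_stepOperator_le f)

end IsStep

end Step

section StepLimitTheorems

variable {E : Type*} [MeasurableSpace E] {P : ∀ N, Measure (Fin N → E)}
  [∀ N, IsProbabilityMeasure (P N)] {μ ν : Measure E}
  [IsProbabilityMeasure ν] {V : (E → ℝ) → ℝ≥0} {C : ℝ} {w : E → ℝ≥0} {K : Kernel E E}

namespace ObeysLimitTheorems

lemma tendsto_empMean_weight (hP : ObeysLimitTheorems P μ V) (h : IsStep C w K μ ν) :
    Tendsto (empMean fun x => (w x : ℝ)) (inProb P) (𝓝 1) := by
  have hint := h.integrable_iff.1 (integrable_const (1 : ℝ))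
  have hmass := h.integral_eq fun _ => 1
  simp only [mul_one, integral_const, probReal_univ, smul_eq_mul] at hint hmass
  rw [hmass]
  exact hP.tendsto_empMean h.measurable.coe_nnreal_real hint

lemma eventually_sum_weight_ne_zero (hP : ObeysLimitTheorems P μ V) (h : IsStep C w K μ ν) :
    ∀ᶠ p in inProb P, ∑ l, w (p.2 l) ≠ 0 := by
  filter_upwards [(hP.tendsto_empMean_weight h).eventually_ne one_ne_zero] with p hp hsum
  refine hp ?_
  rw [empMean, ← NNReal.coe_sum, hsum, NNReal.coe_zero, mul_zero]

lemma approximates_weightedEmpirical (hP : ObeysLimitTheorems P μ V) (h : IsStep C w K μ ν) :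
    Approximates (inProb P) (weightedEmpirical w) ν where
  isProbabilityMeasure := (hP.eventually_sum_weight_ne_zero h).mono fun _ =>
    isProbabilityMeasure_weightedEmpirical
  ae {q} hq hν := by
    have hwq : MeasurableSet {x | w x ≠ 0 → q x} :=
      (h.measurable (measurableSet_singleton 0).compl).imp hq
    exact (hP.eventually_forall hwq (h.ae_iff.1 hν)).mono fun _ => ae_weightedEmpirical hq
  integrable hf _ := .of_forall fun _ => integrable_weightedEmpirical hf
  tendsto_integral hf hfi := by
    have hlim := (hP.tendsto_empMean (h.measurable.coe_nnreal_real.mul hf)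
      (h.integrable_iff.1 hfi)).div (hP.tendsto_empMean_weight h) one_ne_zero
    rw [div_one] at hlim
    simp only [integral_weightedEmpirical hf, h.integral_eq]
    exact hlim

variable [IsMarkovKernel K]

lemma isConditionallyIID_transitionKernel (hP : ObeysLimitTheorems P μ V)
    (h : IsStep C w K μ ν) :
    IsConditionallyIID P (transitionKernel K h.measurable)
      (fun p => K ∘ₘ weightedEmpirical w p) ν where
  eq_pi := (hP.eventually_sum_weight_ne_zero h).mono fun _ =>
    transitionKernel_apply_eq_pi h.measurable
  approximates := by
    have happrox := (hP.approximates_weightedEmpirical h).comp K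
    rwa [h.invariant.def] at happrox

lemma tendsto_sqrt_mul_integral_sub (hP : ObeysLimitTheorems P μ V) (h : IsStep C w K μ ν)
    {f : E → ℝ} (hf : Measurable f) (hf2 : MemLp f 2 ν) (hf0 : ∫ x, f x ∂ν = 0) :
    Tendsto (fun p => √(p.1 : ℝ) * ∫ x, f x ∂(K ∘ₘ weightedEmpirical w p) -
      √(p.1 : ℝ) * empMean (stepOperator w K f) p) (inProb P) (𝓝 0) := by
  have hfi : Integrable f ν := hf2.integrable one_le_two
  have hclt := hP.tendstoInDistribution (measurable_stepOperator (K := K) h.measurable hf)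
    (h.memLp_two_stepOperator hf hf2) ((h.integral_stepOperator hfi).trans hf0)
  have hratio : Tendsto (fun p => (empMean (fun x => (w x : ℝ)) p)⁻¹ - 1) (inProb P) (𝓝 0) := by
    simpa only [inv_one, sub_self] using
      ((hP.tendsto_empMean_weight h).inv₀ one_ne_zero).sub_const 1
  refine (tendsto_mul_inProb_of_tendstoInDistribution
    (X := fun N x => √(N : ℝ) * empMean (stepOperator w K f) ⟨N, x⟩) hclt hratio).congr' ?_
  filter_upwards [(hP.isConditionallyIID_transitionKernel h).approximates.integrable hf hfi]
    with p hp
  have hmean : ∫ x, f x ∂(K ∘ₘ weightedEmpirical w p) =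
      empMean (stepOperator w K f) p / empMean (fun x => (w x : ℝ)) p := by
    rw [integral_comp_measure hp, integral_weightedEmpirical
      (hf.stronglyMeasurable.integral_kernel (κ := K)).measurable]
    rfl
  rw [hmean]
  ring

lemma step (hP : ObeysLimitTheorems P μ V) (h : IsStep C w K μ ν) :
    ObeysLimitTheorems (fun N => transitionKernel K h.measurable N ∘ₘ P N) ν
      fun f => (∫ x, f x ^ 2 ∂ν).toNNReal + V (stepOperator w K f) := by
  have hiid := hP.isConditionallyIID_transitionKernel h
  refine ⟨hiid.eventually_forall, hiid.tendsto_empMean, fun {f} hf hf2 hf0 => ?_⟩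
  have hstep := measurable_stepOperator (K := K) h.measurable hf
  have hclt := hP.tendstoInDistribution hstep (h.memLp_two_stepOperator hf hf2)
    ((h.integral_stepOperator (hf2.integrable one_le_two)).trans hf0)
  rw [← variance_of_integral_eq_zero hf.aemeasurable hf0]
  exact hiid.tendstoInDistribution_sqrt_mul_empMean hf hf2 hclt
    (fun N => (measurable_empMean hstep N).const_mul _)
    (hP.tendsto_sqrt_mul_integral_sub h hf hf2 hf0)

end ObeysLimitTheorems

end StepLimitTheorems

section L2Deviation

variable {X : Type*} [MeasurableSpace X] {ν : Measure X} {κ : Kernel X X} {f : X → ℝ}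

lemma eLpNorm_two_eq_ofReal_sqrt (hf2 : MemLp f 2 ν) :
    eLpNorm f 2 ν = ENNReal.ofReal √(∫ x, f x ^ 2 ∂ν) := by
  rw [hf2.eLpNorm_eq_integral_rpow_norm two_ne_zero ENNReal.ofNat_ne_top, Real.sqrt_eq_rpow]
  simp

lemma l2Deviation_nonneg (κ : Kernel X X) (ν : Measure X) : 0 ≤ l2Deviation κ ν := by
  refine Real.sSup_nonneg ?_
  rintro _ ⟨f, -, -, rfl⟩
  exact ENNReal.toReal_nonneg

variable [IsMarkovKernel κ] [IsProbabilityMeasure ν]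

lemma variance_integral_kernel_le_integral_sq (hκ : Kernel.Invariant κ ν) (hf : Measurable f)
    (hf2 : MemLp f 2 ν) : Var[fun x => ∫ y, f y ∂(κ x); ν] ≤ ∫ x, f x ^ 2 ∂ν := by
  rw [← hκ.def] at hf2
  conv_rhs => rw [← hκ.def]
  exact (variance_le_integral_sq (memLp_two_integral_kernel hf hf2)).trans
    (integral_sq_integral_kernel_le hf hf2)

lemma toReal_eLpNorm_deviation (hκ : Kernel.Invariant κ ν) (hf : Measurable f)
    (hf2 : MemLp f 2 ν) :
    (eLpNorm (fun x => ∫ y, f y ∂(κ x) - ∫ y, f y ∂ν) 2 ν).toReal =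
      √Var[fun x => ∫ y, f y ∂(κ x); ν] := by
  rw [← hκ.def] at hf2
  have hκf := memLp_two_integral_kernel hf hf2
  have hmean : ∫ x, ∫ y, f y ∂(κ x) ∂ν = ∫ y, f y ∂ν := by
    rw [← integral_comp_measure (hf2.integrable one_le_two), hκ.def]
  have hdev : MemLp (fun x => ∫ y, f y ∂(κ x) - ∫ y, f y ∂ν) 2 ν := hκf.sub (memLp_const _)
  rw [eLpNorm_two_eq_ofReal_sqrt hdev, ENNReal.toReal_ofReal (Real.sqrt_nonneg _),
    variance_eq_integral hκf.aemeasurable, hmean]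

lemma sqrt_variance_integral_kernel_le (hκ : Kernel.Invariant κ ν) (hf : Measurable f)
    (hf2 : MemLp f 2 ν) (hf1 : ∫ x, f x ^ 2 ∂ν ≤ 1) :
    √Var[fun x => ∫ y, f y ∂(κ x); ν] ≤ l2Deviation κ ν := by
  have hnorm : ∀ {u : X → ℝ}, MemLp u 2 ν → (eLpNorm u 2 ν ≤ 1 ↔ ∫ x, u x ^ 2 ∂ν ≤ 1) :=
    fun hu => by rw [eLpNorm_two_eq_ofReal_sqrt hu, ENNReal.ofReal_le_one, Real.sqrt_le_one]
  refine le_csSup ⟨1, ?_⟩ ⟨f, hf, (hnorm hf2).2 hf1, (toReal_eLpNorm_deviation hκ hf hf2).symm⟩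
  rintro _ ⟨u, hu, hu1, rfl⟩
  have hu2 : MemLp u 2 ν := ⟨hu.aestronglyMeasurable, hu1.trans_lt ENNReal.one_lt_top⟩
  rw [toReal_eLpNorm_deviation hκ hu hu2, Real.sqrt_le_one]
  exact (variance_integral_kernel_le_integral_sq hκ hu hu2).trans ((hnorm hu2).1 hu1)

lemma variance_integral_kernel_le (hκ : Kernel.Invariant κ ν) (hf : Measurable f)
    (hf2 : MemLp f 2 ν) :
    Var[fun x => ∫ y, f y ∂(κ x); ν] ≤ l2Deviation κ ν ^ 2 * ∫ x, f x ^ 2 ∂ν := by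
  rcases (integral_nonneg fun x => sq_nonneg (f x) : 0 ≤ ∫ x, f x ^ 2 ∂ν).eq_or_lt with h0 | hpos
  · have hle := variance_integral_kernel_le_integral_sq hκ hf hf2
    rwa [← h0, mul_zero] at *
  set M := ∫ x, f x ^ 2 ∂ν
  have hM : (√M)⁻¹ ^ 2 = M⁻¹ := by rw [inv_pow, Real.sq_sqrt hpos.le]
  have hle := sqrt_variance_integral_kernel_le hκ (hf.const_mul (√M)⁻¹) (hf2.const_mul (√M)⁻¹)
    (by simp only [mul_pow, hM, integral_const_mul]; exact (inv_mul_cancel₀ hpos.ne').le)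
  simp only [integral_const_mul, variance_const_mul, hM] at hle
  rwa [Real.sqrt_le_left (l2Deviation_nonneg κ ν), inv_mul_le_iff₀ hpos, mul_comm M] at hle

end L2Deviation

section Mode

variable {E : Type*} [MeasurableSpace E] {ν : Measure E} {K : Kernel E E} {S : Set E} {f : E → ℝ}

/-- The set `S` is a mode that `K` does not mix with its complement: `K` neither leaves nor
enters `S`. -/
def IsIsolated (K : Kernel E E) (S : Set E) : Prop := ∀ x, K x S = S.indicator 1 x

lemma IsIsolated.apply_of_mem (h : IsIsolated K S) {x : E} (hx : x ∈ S) : K x S = 1 := by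
  rw [h x, Set.indicator_of_mem hx, Pi.one_apply]

lemma isIsolated_of_partition {m : ℕ} {F : Fin m → Set E}
    (hFdisj : Pairwise fun r s => Disjoint (F r) (F s)) (hFcover : ⋃ r, F r = Set.univ)
    (hF : ∀ r, MeasurableSet (F r)) [IsMarkovKernel K] (hnomix : ∀ r, ∀ x ∈ F r, K x (F r) = 1)
    (r : Fin m) : IsIsolated K (F r) := by
  intro x
  by_cases hx : x ∈ F r
  · rw [hnomix r x hx, Set.indicator_of_mem hx, Pi.one_apply]
  · obtain ⟨s, hs⟩ := Set.mem_iUnion.1 (hFcover ▸ Set.mem_univ x)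
    have hrs : r ≠ s := fun h => hx (h ▸ hs)
    rw [Set.indicator_of_notMem hx]
    exact measure_mono_null (hFdisj hrs).subset_compl_right
      ((prob_compl_eq_zero_iff (hF s)).2 (hnomix s x hs))

lemma integral_modeMeasure (hS : MeasurableSet S) (f : E → ℝ) :
    ∫ x : S, f x ∂(modeMeasure ν S) = (ν.real S)⁻¹ * ∫ x in S, f x ∂ν := by
  rw [modeMeasure, integral_subtype_comap hS, ProbabilityTheory.cond, Measure.restrict_smul,
    Measure.restrict_restrict hS, Set.inter_self, integral_smul_measure, smul_eq_mul,
    ENNReal.toReal_inv, measureReal_def]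

lemma map_val_modeMeasure (hS : MeasurableSet S) :
    (modeMeasure ν S).map Subtype.val = ν[|S] := by
  rw [modeMeasure, (MeasurableEmbedding.subtype_coe hS).map_comap, Subtype.range_coe,
    ProbabilityTheory.cond, Measure.restrict_smul, Measure.restrict_restrict hS, Set.inter_self]

lemma isProbabilityMeasure_modeMeasure [IsFiniteMeasure ν] (hS : MeasurableSet S) (h0 : ν S ≠ 0) :
    IsProbabilityMeasure (modeMeasure ν S) := by
  have : IsProbabilityMeasure ((modeMeasure ν S).map Subtype.val) := by
    rw [map_val_modeMeasure hS]
    exact cond_isProbabilityMeasure h0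
  exact Measure.isProbabilityMeasure_of_map Subtype.val

namespace IsIsolated

variable [IsMarkovKernel K]

lemma map_val_modeKernel (h : IsIsolated K S) (hS : MeasurableSet S) (x : S) :
    (modeKernel K hS x).map Subtype.val = K x := by
  rw [modeKernel, Kernel.comapRight_apply, Kernel.comap_apply,
    (MeasurableEmbedding.subtype_coe hS).map_comap, Subtype.range_coe]
  exact Measure.restrict_eq_self_of_ae_mem
    ((prob_compl_eq_zero_iff hS).2 (h.apply_of_mem x.2) : K x Sᶜ = 0)

lemma isMarkovKernel_modeKernel (h : IsIsolated K S) (hS : MeasurableSet S) :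
    IsMarkovKernel (modeKernel K hS) := by
  refine ⟨fun x => ?_⟩
  have : IsProbabilityMeasure ((modeKernel K hS x).map Subtype.val) := by
    rw [h.map_val_modeKernel hS]
    infer_instance
  exact Measure.isProbabilityMeasure_of_map Subtype.val

lemma integral_modeKernel (h : IsIsolated K S) (hS : MeasurableSet S) (f : E → ℝ) (x : S) :
    ∫ y : S, f y ∂(modeKernel K hS x) = ∫ y, f y ∂(K x) := by
  rw [← h.map_val_modeKernel hS x, (MeasurableEmbedding.subtype_coe hS).integral_map]

lemma invariant_restrict (h : IsIsolated K S) (hS : MeasurableSet S)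
    (hK : Kernel.Invariant K ν) : Kernel.Invariant K (ν.restrict S) := by
  ext B hB
  have hin : ∀ x ∈ S, K x B = K x (B ∩ S) := fun x hx =>
    (measure_inter_conull (t := S) ((prob_compl_eq_zero_iff hS).2 (h.apply_of_mem hx))).symm
  have hout : (fun x => K x (B ∩ S)).support ⊆ S := fun x hx => by
    by_contra hxS
    exact hx (measure_mono_null Set.inter_subset_right
      ((h x).trans (Set.indicator_of_notMem hxS _)))
  rw [Measure.bind_apply hB K.aemeasurable, setLIntegral_congr_fun hS hin,
    setLIntegral_eq_of_support_subset hout, ← Measure.bind_apply (hB.inter hS) K.aemeasurable,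
    hK.def, Measure.restrict_apply hB]

lemma invariant_modeKernel (h : IsIsolated K S) (hS : MeasurableSet S)
    (hK : Kernel.Invariant K ν) : Kernel.Invariant (modeKernel K hS) (modeMeasure ν S) := by
  have hval : Measurable (Subtype.val : S → E) := measurable_subtype_coe
  have hkernel : (modeKernel K hS).map Subtype.val = K.comap Subtype.val hval := by
    ext1 x
    rw [Kernel.map_apply _ hval, h.map_val_modeKernel hS, Kernel.comap_apply]
  have hcond : K ∘ₘ ν[|S] = ν[|S] := by
    rw [ProbabilityTheory.cond, Measure.comp_smul, (h.invariant_restrict hS hK).def]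
  refine (MeasurableEmbedding.subtype_coe hS).map_injective ?_
  rw [Measure.map_comp _ _ hval, hkernel, ← Kernel.comp_deterministic_eq_comap,
    ← Measure.comp_assoc, Measure.deterministic_comp_eq_map, map_val_modeMeasure hS, hcond]

lemma setIntegral_sq_integral_le [IsFiniteMeasure ν] (h : IsIsolated K S) (hS : MeasurableSet S)
    (h0 : ν S ≠ 0) (hK : Kernel.Invariant K ν) (hf : Measurable f) (hf2 : MemLp f 2 ν) :
    ∫ x in S, (∫ y, f y ∂(K x)) ^ 2 ∂ν ≤
      l2Deviation (modeKernel K hS) (modeMeasure ν S) ^ 2 * ∫ x in S, f x ^ 2 ∂ν +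
        (∫ x in S, f x ∂ν) ^ 2 / ν.real S := by
  have := isProbabilityMeasure_modeMeasure hS h0
  have := h.isMarkovKernel_modeKernel hS
  have hinv := h.invariant_modeKernel hS hK
  have hc : 0 < ν.real S := ENNReal.toReal_pos h0 (measure_ne_top _ _)
  have hfm : Measurable fun x : S => f x := hf.comp measurable_subtype_coe
  have hfS : MemLp (fun x : S => f x) 2 (modeMeasure ν S) := by
    refine ((MeasurableEmbedding.subtype_coe hS).memLp_map_measure_iff (g := f)).1 ?_
    rw [map_val_modeMeasure hS]
    exact (hf2.restrict S).smul_measure (ENNReal.inv_ne_top.2 h0)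
  have hmean := integral_comp_measure (κ := modeKernel K hS) (μ := modeMeasure ν S)
    (f := fun x => f x) (by rw [hinv.def]; exact hfS.integrable one_le_two)
  have hvar := variance_integral_kernel_le hinv hfm hfS
  rw [variance_eq_sub (memLp_two_integral_kernel hfm (by rwa [hinv.def]))] at hvar
  rw [← hmean, hinv.def] at hvar
  simp only [Pi.pow_apply, h.integral_modeKernel hS f,
    integral_modeMeasure hS fun x => (∫ y, f y ∂(K x)) ^ 2,
    integral_modeMeasure hS fun x => f x ^ 2, integral_modeMeasure hS f] at hvar
  rw [sub_le_iff_le_add, inv_mul_le_iff₀ hc] at hvar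
  refine hvar.trans_eq ?_
  field_simp

end IsIsolated

end Mode

section StepOnMode

variable {E : Type*} [MeasurableSpace E] {C : ℝ} {w : E → ℝ≥0} {K : Kernel E E} {μ ν : Measure E}
  {f : E → ℝ} {S : Set E} [IsMarkovKernel K]

lemma IsStep.restrict (h : IsStep C w K μ ν) (hS : MeasurableSet S) (hiso : IsIsolated K S) :
    IsStep C w K (μ.restrict S) (ν.restrict S) where
  measurable := h.measurable
  le_bound := h.le_bound
  eq_withDensity := by rw [h.eq_withDensity, restrict_withDensity hS]
  invariant := hiso.invariant_restrict hS h.invariant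

lemma IsStep.setIntegral_sq_stepOperator_le [IsFiniteMeasure ν] (h : IsStep C w K μ ν)
    (hC : 0 ≤ C) (hS : MeasurableSet S) (h0 : ν S ≠ 0) (hiso : IsIsolated K S)
    (hf : Measurable f) (hf2 : MemLp f 2 ν) :
    ∫ x in S, stepOperator w K f x ^ 2 ∂μ ≤
      C * (l2Deviation (modeKernel K hS) (modeMeasure ν S) ^ 2 * ∫ x in S, f x ^ 2 ∂ν +
        (∫ x in S, f x ∂ν) ^ 2 / ν.real S) :=
  ((h.restrict hS hiso).integral_sq_stepOperator_le hf (hf2.restrict S)).trans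
    (mul_le_mul_of_nonneg_left
      (hiso.setIntegral_sq_integral_le hS h0 h.invariant hf hf2) hC)

lemma sq_setIntegral_le_measureReal_mul [IsFiniteMeasure ν] (hS : ν S ≠ 0) (hf2 : MemLp f 2 ν) :
    (∫ x in S, f x ∂ν) ^ 2 ≤ ν.real S * ∫ x in S, f x ^ 2 ∂ν := by
  have := cond_isProbabilityMeasure hS
  have hc : 0 < ν.real S := ENNReal.toReal_pos hS (measure_ne_top _ _)
  have hsq := sq_integral_le_integral_sq (ν := ν[|S])
    ((hf2.restrict S).smul_measure (ENNReal.inv_ne_top.2 hS))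
  simp only [ProbabilityTheory.cond, integral_smul_measure, ENNReal.toReal_inv, smul_eq_mul,
    ← measureReal_def] at hsq
  rw [le_inv_mul_iff₀ hc] at hsq
  field_simp at hsq
  exact hsq

end StepOnMode

section Propagate

variable {E : Type*} [MeasurableSpace E] {n : ℕ} {μ : ℕ → Measure E} {g : ℕ → E → ℝ≥0}
  {K : ℕ → Kernel E E} {φ : E → ℝ} {C : ℝ}

lemma propagate_succ (φ : E → ℝ) (k d : ℕ) :
    propagate g K φ k (d + 1) = stepOperator (g k) (K (k + 1)) (propagate g K φ (k + 1) d) :=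
  rfl

lemma propagate_sub {k : ℕ} (φ : E → ℝ) (hk : k < n) :
    propagate g K φ k (n - k) =
      stepOperator (g k) (K (k + 1)) (propagate g K φ (k + 1) (n - (k + 1))) := by
  rw [← propagate_succ]
  congr 1
  omega

lemma propagate_succ_right (φ : E → ℝ) (k d : ℕ) :
    propagate g K φ k (d + 1) =
      propagate g K (stepOperator (g (k + d)) (K (k + d + 1)) φ) k d := by
  induction d generalizing k with
  | zero => rfl
  | succ d ih => rw [propagate_succ, ih, propagate_succ, Nat.add_right_comm k 1 d, add_assoc k d]

lemma measurable_propagate (hg : ∀ k, Measurable (g k)) (hφ : Measurable φ) (k d : ℕ) :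
    Measurable (propagate g K φ k d) := by
  induction d generalizing k with
  | zero => exact hφ
  | succ d ih => exact measurable_stepOperator (hg k) (ih (k + 1))

lemma stageVariance_self (φ : E → ℝ) (n : ℕ) :
    stageVariance μ g K φ n n = ∫ x, φ x ^ 2 ∂(μ n) := by
  rw [stageVariance, Nat.sub_self, propagate]

lemma asymptoticVariance_nonneg (φ : E → ℝ) (n : ℕ) : 0 ≤ asymptoticVariance μ g K φ n :=
  Finset.sum_nonneg fun _ _ => integral_nonneg fun _ => sq_nonneg _

lemma asymptoticVariance_succ (φ : E → ℝ) (n : ℕ) :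
    asymptoticVariance μ g K φ (n + 1) = ∫ x, φ x ^ 2 ∂(μ (n + 1)) +
      asymptoticVariance μ g K (stepOperator (g n) (K (n + 1)) φ) n := by
  rw [asymptoticVariance, Finset.sum_range_succ, stageVariance_self, add_comm, asymptoticVariance]
  congr 1
  refine Finset.sum_congr rfl fun k hk => ?_
  have hkn : k ≤ n := Nat.lt_succ_iff.1 (Finset.mem_range.1 hk)
  rw [stageVariance, stageVariance, Nat.succ_sub hkn, propagate_succ_right,
    Nat.add_sub_cancel' hkn]

variable [∀ k, IsMarkovKernel (K k)]

lemma memLp_two_propagate (hg : ∀ k, Measurable (g k))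
    (hstep : ∀ k < n, IsStep C (g k) (K (k + 1)) (μ k) (μ (k + 1))) (hφ : Measurable φ)
    (hφ2 : MemLp φ 2 (μ n)) {k : ℕ} (hk : k ≤ n) :
    MemLp (propagate g K φ k (n - k)) 2 (μ k) := by
  induction hk using Nat.decreasingInduction with
  | of_succ k hk ih =>
    rw [propagate_sub φ hk]
    exact (hstep k hk).memLp_two_stepOperator (measurable_propagate hg hφ _ _) ih
  | self => rwa [Nat.sub_self, propagate]

lemma setIntegral_propagate [∀ k, IsFiniteMeasure (μ k)] (hg : ∀ k, Measurable (g k))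
    (hstep : ∀ k < n, IsStep C (g k) (K (k + 1)) (μ k) (μ (k + 1))) (hφ : Measurable φ)
    (hφ2 : MemLp φ 2 (μ n)) {S : Set E} (hS : MeasurableSet S)
    (hiso : ∀ k < n, IsIsolated (K (k + 1)) S) {k : ℕ} (hk : k ≤ n) :
    ∫ x in S, propagate g K φ k (n - k) x ∂(μ k) = ∫ x in S, φ x ∂(μ n) := by
  induction hk using Nat.decreasingInduction with
  | of_succ k hk ih =>
    rw [propagate_sub φ hk, ((hstep k hk).restrict hS (hiso k hk)).integral_stepOperator
      ((memLp_two_propagate hg hstep hφ hφ2 hk).integrable one_le_two).restrict, ih]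
  | self => rw [Nat.sub_self, propagate]

end Propagate

section ParticleSystem

variable {E : Type*} [MeasurableSpace E] {n : ℕ} {μ : ℕ → Measure E}
  [∀ k, IsProbabilityMeasure (μ k)] {g : ℕ → E → ℝ≥0} {K : ℕ → Kernel E E}
  [∀ k, IsMarkovKernel (K k)] {φ : E → ℝ} {C : ℝ}

lemma particleLaw_succ (μ₀ : Measure E) (hg : ∀ k, Measurable (g k)) (N k : ℕ) :
    particleLaw μ₀ g hg K N (k + 1) =
      transitionKernel (K (k + 1)) (hg k) N ∘ₘ particleLaw μ₀ g hg K N k :=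
  Measure.comp_assoc

lemma obeysLimitTheorems_particleLaw (hg : ∀ k, Measurable (g k))
    (hstep : ∀ k < n, IsStep C (g k) (K (k + 1)) (μ k) (μ (k + 1))) {k : ℕ} (hk : k ≤ n) :
    ObeysLimitTheorems (fun N => particleLaw (μ 0) g hg K N k) (μ k)
      fun f => (asymptoticVariance μ g K f k).toNNReal := by
  induction k with
  | zero =>
    simp only [asymptoticVariance, zero_add, Finset.sum_range_one, stageVariance_self]
    exact obeysLimitTheorems_pi (μ 0)
  | succ k ih =>
    simp only [asymptoticVariance_succ, particleLaw_succ,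
      Real.toNNReal_add (integral_nonneg fun _ => sq_nonneg _) (asymptoticVariance_nonneg _ _)]
    exact (ih (Nat.le_of_succ_le hk)).step (hstep k hk)

lemma tendstoInDistribution_scaledError (hg : ∀ k, Measurable (g k))
    (hstep : ∀ k < n, IsStep C (g k) (K (k + 1)) (μ k) (μ (k + 1))) (hφ : Measurable φ)
    (hφ2 : MemLp φ 2 (μ n)) (hφ0 : ∫ x, φ x ∂(μ n) = 0) :
    TendstoInDistribution (fun N : ℕ => scaledError (μ n) φ N) atTop (id : ℝ → ℝ)
      (fun N : ℕ => particleLaw (μ 0) g hg K N n)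
      (gaussianReal 0 (asymptoticVariance μ g K φ n).toNNReal) := by
  have herr : (fun N : ℕ => scaledError (μ n) φ N) =
      fun (N : ℕ) x => √(N : ℝ) * empMean φ ⟨N, x⟩ := by
    funext N x
    rw [scaledError, hφ0, sub_zero, empMean]
  rw [herr]
  exact (obeysLimitTheorems_particleLaw hg hstep le_rfl).tendstoInDistribution hφ hφ2 hφ0

end ParticleSystem

section Constants

variable {E : Type*} [MeasurableSpace E] {n m : ℕ} {μ : ℕ → Measure E} {g : ℕ → E → ℝ≥0}
  {K : ℕ → Kernel E E} {F : Fin m → Set E}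

lemma coe_le_maxDensity {X : Type*} {g : ℕ → X → ℝ≥0}
    (hgb : ∀ k < n, BddAbove (Set.range fun x => (g k x : ℝ))) {k : ℕ} (hk : k < n) (x : X) :
    (g k x : ℝ) ≤ maxDensity g n :=
  (le_ciSup (hgb k hk) x).trans
    (le_ciSup (f := fun k : Fin n => ⨆ x : X, (g k x : ℝ)) (Set.finite_range _).bddAbove ⟨k, hk⟩)

lemma isStep_maxDensity (hg : ∀ k, Measurable (g k))
    (hμg : ∀ k < n, μ (k + 1) = (μ k).withDensity fun x => (g k x : ℝ≥0∞))
    (hgb : ∀ k < n, BddAbove (Set.range fun x => (g k x : ℝ)))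
    (hK : ∀ k, 1 ≤ k → k ≤ n → Kernel.Invariant (K k) (μ k)) (k : ℕ) (hk : k < n) :
    IsStep (maxDensity g n) (g k) (K (k + 1)) (μ k) (μ (k + 1)) :=
  ⟨hg k, coe_le_maxDensity hgb hk, hμg k hk, hK (k + 1) k.succ_pos hk⟩

lemma l2Deviation_le_one_sub_localGap (hF : ∀ r, MeasurableSet (F r)) {k : ℕ} (hk : k < n)
    (r : Fin m) : l2Deviation (modeKernel (K (k + 1)) (hF r)) (modeMeasure (μ (k + 1)) (F r)) ≤
      1 - localGap μ K F hF n := by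
  rw [localGap, sub_sub_cancel]
  refine (le_ciSup (f := fun r : Fin m => l2Deviation (modeKernel (K (k + 1)) (hF r))
    (modeMeasure (μ (k + 1)) (F r))) (Set.finite_range _).bddAbove r).trans ?_
  exact le_ciSup (f := fun k : Fin n => ⨆ r : Fin m, l2Deviation
    (modeKernel (K (k + 1)) (hF r)) (modeMeasure (μ (k + 1)) (F r)))
    (Set.finite_range _).bddAbove ⟨k, hk⟩

lemma sum_setIntegral_eq {ν : Measure E} (hF : ∀ r, MeasurableSet (F r))
    (hFdisj : Pairwise fun r s => Disjoint (F r) (F s)) (hFcover : ⋃ r, F r = Set.univ)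
    {f : E → ℝ} (hf : Integrable f ν) : ∑ r, ∫ x in F r, f x ∂ν = ∫ x, f x ∂ν := by
  rw [← integral_iUnion_fintype hF hFdisj fun r => hf.integrableOn, hFcover, setIntegral_univ]

lemma sum_measureReal_eq_one {ν : Measure E} [IsProbabilityMeasure ν]
    (hF : ∀ r, MeasurableSet (F r)) (hFdisj : Pairwise fun r s => Disjoint (F r) (F s))
    (hFcover : ⋃ r, F r = Set.univ) : ∑ r, ν.real (F r) = 1 := by
  simpa only [integral_const, measureReal_restrict_apply_univ, probReal_univ, smul_eq_mul, mul_one]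
    using sum_setIntegral_eq (ν := ν) hF hFdisj hFcover (integrable_const (1 : ℝ))

lemma measureReal_le_growthWithinMode_mul [∀ k, IsFiniteMeasure (μ k)] {j k : ℕ} (hjk : j < k)
    (hk : k ≤ n) {r : Fin m} (h0 : μ j (F r) ≠ 0) :
    (μ k).real (F r) ≤ growthWithinMode μ F n * (μ j).real (F r) := by
  have hpos : 0 < (μ j).real (F r) := ENNReal.toReal_pos h0 (measure_ne_top _ _)
  rw [← div_le_iff₀ hpos]
  refine le_csSup ?_ ⟨j, k, r, hjk, hk, rfl⟩
  refine ((Set.finite_range fun q : Fin (n + 1) × Fin (n + 1) × Fin m =>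
    (μ q.2.1).real (F q.2.2) / (μ q.1).real (F q.2.2)).subset ?_).bddAbove
  rintro _ ⟨j, k, r, hjk, hk, rfl⟩
  exact ⟨⟨⟨j, by omega⟩, ⟨k, by omega⟩, r⟩, rfl⟩

end Constants

lemma le_div_one_sub_of_le_mul_succ_add {a : ℕ → ℝ} {n : ℕ} {ρ c : ℝ} (hρ0 : 0 ≤ ρ) (hρ1 : ρ < 1)
    (hn : a n ≤ c / (1 - ρ)) (hrec : ∀ k < n, a k ≤ ρ * a (k + 1) + c) {k : ℕ} (hk : k ≤ n) :
    a k ≤ c / (1 - ρ) := by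
  induction hk using Nat.decreasingInduction with
  | of_succ k hk ih =>
    calc a k ≤ ρ * a (k + 1) + c := hrec k hk
      _ ≤ ρ * (c / (1 - ρ)) + c := by gcongr
      _ = c / (1 - ρ) := by
        have : 1 - ρ ≠ 0 := (sub_pos.2 hρ1).ne'
        field_simp
        ring
  | self => exact hn

section VarianceBound

variable {E : Type*} [MeasurableSpace E] {n m : ℕ} {μ : ℕ → Measure E} {g : ℕ → E → ℝ≥0}
  {K : ℕ → Kernel E E} {F : Fin m → Set E} {φ : E → ℝ} {C A : ℝ}

/-- The sets `F r` are modes of the distributions `μ 1, …, μ n` that the kernels `K 1, …, K n` do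
not mix: a measurable partition into isolated sets of positive mass. -/
structure IsModePartition (n : ℕ) (μ : ℕ → Measure E) (K : ℕ → Kernel E E) (F : Fin m → Set E) :
    Prop where
  measurableSet : ∀ r, MeasurableSet (F r)
  disjoint : Pairwise fun r s => Disjoint (F r) (F s)
  iUnion_eq : ⋃ r, F r = Set.univ
  measure_ne_zero : ∀ r, ∀ k < n, μ (k + 1) (F r) ≠ 0
  isIsolated : ∀ r, ∀ k < n, IsIsolated (K (k + 1)) (F r)

lemma isModePartition_of_noMixing [∀ k, IsMarkovKernel (K k)] (hF : ∀ r, MeasurableSet (F r))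
    (hFdisj : Pairwise fun r s => Disjoint (F r) (F s)) (hFcover : ⋃ r, F r = Set.univ)
    (hFpos : ∀ k, 1 ≤ k → k ≤ n → ∀ r, 0 < μ k (F r))
    (hnomix : ∀ k, 1 ≤ k → k ≤ n → ∀ r, ∀ x ∈ F r, K k x (F r) = 1) :
    IsModePartition n μ K F where
  measurableSet := hF
  disjoint := hFdisj
  iUnion_eq := hFcover
  measure_ne_zero r k hk := (hFpos (k + 1) k.succ_pos hk r).ne'
  isIsolated r k hk :=
    isIsolated_of_partition hFdisj hFcover hF (hnomix (k + 1) k.succ_pos hk) r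

lemma IsModePartition.measure_zero_ne_zero (hF : IsModePartition n μ K F)
    (hstep : ∀ k < n, IsStep C (g k) (K (k + 1)) (μ k) (μ (k + 1))) (hn : 0 < n) (r : Fin m) :
    μ 0 (F r) ≠ 0 := by
  have hac : μ 1 ≪ μ 0 := by
    rw [(hstep 0 hn).eq_withDensity]
    exact withDensity_absolutelyContinuous _ _
  exact fun h => hF.measure_ne_zero r 0 hn (hac h)

variable [∀ k, IsProbabilityMeasure (μ k)]

lemma IsModePartition.one_le_growthWithinMode (hF : IsModePartition n μ K F)
    (hstep : ∀ k < n, IsStep C (g k) (K (k + 1)) (μ k) (μ (k + 1))) (hn : 0 < n) :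
    1 ≤ growthWithinMode μ F n :=
  have hsum (k : ℕ) : ∑ r, (μ k).real (F r) = 1 :=
    sum_measureReal_eq_one hF.measurableSet hF.disjoint hF.iUnion_eq
  calc (1 : ℝ) = ∑ r, (μ 1).real (F r) := (hsum 1).symm
    _ ≤ ∑ r, growthWithinMode μ F n * (μ 0).real (F r) := Finset.sum_le_sum fun r _ =>
        measureReal_le_growthWithinMode_mul zero_lt_one hn (hF.measure_zero_ne_zero hstep hn r)
    _ = growthWithinMode μ F n := by rw [← Finset.mul_sum, hsum, mul_one]

lemma IsModePartition.measureReal_le_growthWithinMode_mul (hF : IsModePartition n μ K F)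
    (hstep : ∀ k < n, IsStep C (g k) (K (k + 1)) (μ k) (μ (k + 1))) {k : ℕ} (hk : k < n)
    (r : Fin m) : (μ n).real (F r) ≤ growthWithinMode μ F n * (μ (k + 1)).real (F r) := by
  rcases (Nat.succ_le_of_lt hk).eq_or_lt with rfl | hlt
  · exact le_mul_of_one_le_left measureReal_nonneg
      (hF.one_le_growthWithinMode hstep k.succ_pos)
  · exact SMC.measureReal_le_growthWithinMode_mul hlt le_rfl (hF.measure_ne_zero r k hk)

variable [∀ k, IsMarkovKernel (K k)]

lemma setIntegral_sq_propagate_le (hg : ∀ k, Measurable (g k))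
    (hstep : ∀ k < n, IsStep C (g k) (K (k + 1)) (μ k) (μ (k + 1)))
    (hφ : Measurable φ) (hφ2 : MemLp φ 2 (μ n)) {S : Set E} (hS : MeasurableSet S)
    (hiso : ∀ k < n, IsIsolated (K (k + 1)) S) (h0 : ∀ k < n, μ (k + 1) S ≠ 0)
    (hA : ∀ k < n, (μ n).real S ≤ A * (μ (k + 1)).real S) {k : ℕ} (hk : k < n) :
    ∫ x in S, propagate g K φ k (n - k) x ^ 2 ∂(μ k) ≤
      C * (l2Deviation (modeKernel (K (k + 1)) hS) (modeMeasure (μ (k + 1)) S) ^ 2 *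
        ∫ x in S, propagate g K φ (k + 1) (n - (k + 1)) x ^ 2 ∂(μ (k + 1)) +
          A * ∫ x in S, φ x ^ 2 ∂(μ n)) := by
  have hC : 0 ≤ C := zero_le_one.trans (hstep k hk).one_le_bound
  have hpos : 0 < (μ (k + 1)).real S := ENNReal.toReal_pos (h0 k hk) (measure_ne_top _ _)
  have hn0 : μ n S ≠ 0 := by
    have := h0 (n - 1) (by omega)
    rwa [Nat.sub_add_cancel (by omega)] at this
  have hφS : 0 ≤ ∫ x in S, φ x ^ 2 ∂(μ n) := integral_nonneg fun _ => sq_nonneg _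
  have hmass : (∫ x in S, φ x ∂(μ n)) ^ 2 / (μ (k + 1)).real S ≤
      A * ∫ x in S, φ x ^ 2 ∂(μ n) := by
    rw [div_le_iff₀ hpos, mul_right_comm]
    exact (sq_setIntegral_le_measureReal_mul hn0 hφ2).trans
      (mul_le_mul_of_nonneg_right (hA k hk) hφS)
  have hle := (hstep k hk).setIntegral_sq_stepOperator_le hC hS (h0 k hk) (hiso k hk)
    (measurable_propagate hg hφ _ _) (memLp_two_propagate hg hstep hφ hφ2 hk)
  rw [setIntegral_propagate hg hstep hφ hφ2 hS hiso hk] at hle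
  rw [propagate_sub φ hk]
  exact hle.trans (mul_le_mul_of_nonneg_left (add_le_add_right hmass _) hC)

lemma stageVariance_le (hg : ∀ k, Measurable (g k))
    (hstep : ∀ k < n, IsStep C (g k) (K (k + 1)) (μ k) (μ (k + 1)))
    (hF : IsModePartition n μ K F) (hφ : Measurable φ) (hφ2 : MemLp φ 2 (μ n)) {k : ℕ}
    (hk : k < n) :
    stageVariance μ g K φ k n ≤
      (1 - localGap μ K F hF.measurableSet n) ^ 2 * C * stageVariance μ g K φ (k + 1) n +
        growthWithinMode μ F n * C * ∫ x, φ x ^ 2 ∂(μ n) := by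
  have hC : 0 ≤ C := zero_le_one.trans (hstep k hk).one_le_bound
  have hsum {j : ℕ} (hj : j ≤ n) : ∑ r, ∫ x in F r, propagate g K φ j (n - j) x ^ 2 ∂(μ j) =
      stageVariance μ g K φ j n :=
    sum_setIntegral_eq hF.measurableSet hF.disjoint hF.iUnion_eq
      (memLp_two_propagate hg hstep hφ hφ2 hj).integrable_sq
  rw [← hsum hk.le, ← hsum hk, ← stageVariance_self (g := g) (K := K), ← hsum le_rfl,
    Finset.mul_sum, Finset.mul_sum, ← Finset.sum_add_distrib, Nat.sub_self]
  refine Finset.sum_le_sum fun r _ =>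
    (setIntegral_sq_propagate_le hg hstep hφ hφ2 (hF.measurableSet r) (hF.isIsolated r)
      (hF.measure_ne_zero r) (fun _ hj => hF.measureReal_le_growthWithinMode_mul hstep hj r)
      hk).trans ?_
  have hgap := pow_le_pow_left₀ (l2Deviation_nonneg _ _)
    (l2Deviation_le_one_sub_localGap (μ := μ) (K := K) hF.measurableSet hk r) 2
  have hI : 0 ≤ ∫ x in F r, propagate g K φ (k + 1) (n - (k + 1)) x ^ 2 ∂(μ (k + 1)) :=
    integral_nonneg fun _ => sq_nonneg _
  rw [mul_comm _ C, mul_assoc C, mul_comm _ C, mul_assoc C, ← mul_add]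
  exact mul_le_mul_of_nonneg_left (add_le_add_left (mul_le_mul_of_nonneg_right hgap hI) _) hC

lemma asymptoticVariance_le (hg : ∀ k, Measurable (g k))
    (hstep : ∀ k < n, IsStep C (g k) (K (k + 1)) (μ k) (μ (k + 1)))
    (hF : IsModePartition n μ K F)
    (hgap : (1 - localGap μ K F hF.measurableSet n) ^ 2 * C < 1) (hφ : Measurable φ)
    (hφ2 : MemLp φ 2 (μ n)) :
    asymptoticVariance μ g K φ n ≤
      (1 + n * growthWithinMode μ F n * C /
        (1 - (1 - localGap μ K F hF.measurableSet n) ^ 2 * C)) * ∫ x, φ x ^ 2 ∂(μ n) := by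
  set ρ := (1 - localGap μ K F hF.measurableSet n) ^ 2 * C
  set v := ∫ x, φ x ^ 2 ∂(μ n)
  have hv : 0 ≤ v := integral_nonneg fun _ => sq_nonneg _
  have hstage : ∀ k ∈ Finset.range n,
      stageVariance μ g K φ k n ≤ growthWithinMode μ F n * C * v / (1 - ρ) := by
    intro k hk
    have hkn : k < n := Finset.mem_range.1 hk
    have hC : 1 ≤ C := (hstep k hkn).one_le_bound
    have hA : 1 ≤ growthWithinMode μ F n := hF.one_le_growthWithinMode hstep (by omega)
    have hρ : 0 ≤ ρ := mul_nonneg (sq_nonneg _) (zero_le_one.trans hC)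
    refine le_div_one_sub_of_le_mul_succ_add
      (a := fun j => stageVariance μ g K φ j n) hρ hgap ?_
      (fun j hj => stageVariance_le hg hstep hF hφ hφ2 hj) hkn.le
    calc stageVariance μ g K φ n n = v := stageVariance_self φ n
      _ ≤ growthWithinMode μ F n * C * v :=
        le_mul_of_one_le_left hv (one_le_mul_of_one_le_of_one_le hA hC)
      _ ≤ _ := le_div_self (by positivity) (sub_pos.2 hgap) (sub_le_self 1 hρ)
  calc asymptoticVariance μ g K φ n = ∑ k ∈ Finset.range n, stageVariance μ g K φ k n + v := by
        rw [asymptoticVariance, Finset.sum_range_succ, stageVariance_self]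
    _ ≤ n • (growthWithinMode μ F n * C * v / (1 - ρ)) + v := by
        grw [Finset.sum_le_card_nsmul _ _ _ hstage, Finset.card_range]
    _ = _ := by rw [nsmul_eq_mul]; ring

end VarianceBound

lemma memLp_two_of_integrable_rpow {E : Type*} [MeasurableSpace E] {ν : Measure E}
    [IsFiniteMeasure ν] {φ : E → ℝ} (hφ : AEStronglyMeasurable φ ν) {ε : ℝ} (hε : 0 ≤ ε)
    (h : Integrable (fun x => |φ x| ^ (2 + ε)) ν) : MemLp φ 2 ν := by
  have hp : MemLp φ (ENNReal.ofReal (2 + ε)) ν := by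
    refine (integrable_norm_rpow_iff hφ (ENNReal.ofReal_pos.2 (by linarith)).ne'
      ENNReal.ofReal_ne_top).1 ?_
    simpa only [ENNReal.toReal_ofReal (by linarith : 0 ≤ 2 + ε), Real.norm_eq_abs] using h
  refine hp.mono_exponent ?_
  rw [← ENNReal.ofReal_ofNat]
  exact ENNReal.ofReal_le_ofReal (by linarith)

end SMC

end

theorem mainTheorem5_general {E : Type*} [MeasurableSpace E] (n : ℕ)
    (μ : ℕ → Measure E) [∀ k, IsProbabilityMeasure (μ k)]
    (g : ℕ → E → ℝ≥0) (hg : ∀ k, Measurable (g k))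
    (hμg : ∀ k < n, μ (k + 1) = (μ k).withDensity fun x => (g k x : ℝ≥0∞))
    (hgb : ∀ k < n, BddAbove (Set.range fun x => (g k x : ℝ)))
    (K : ℕ → Kernel E E) [∀ k, IsMarkovKernel (K k)]
    (hK : ∀ k, 1 ≤ k → k ≤ n → Kernel.Invariant (K k) (μ k))
    (m : ℕ) (F : Fin m → Set E) (hF : ∀ r, MeasurableSet (F r))
    (hFdisj : Pairwise fun r s => Disjoint (F r) (F s)) (hFcover : ⋃ r, F r = Set.univ)
    (hFpos : ∀ k, 1 ≤ k → k ≤ n → ∀ r, 0 < μ k (F r))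
    (hnomix : ∀ k, 1 ≤ k → k ≤ n → ∀ r, ∀ x ∈ F r, K k x (F r) = 1)
    (hΓγ : (1 - SMC.localGap μ K F hF n) ^ 2 * SMC.maxDensity g n < 1)
    (φ : E → ℝ) (hφ : Measurable φ) (hφ2 : MemLp φ 2 (μ n))
    (hφ0 : ∫ x, φ x ∂(μ n) = 0) :
    TendstoInDistribution (fun N : ℕ => SMC.scaledError (μ n) φ N) atTop (id : ℝ → ℝ)
      (fun N : ℕ => SMC.particleLaw (μ 0) g hg K N n)
      (gaussianReal 0 (SMC.asymptoticVariance μ g K φ n).toNNReal) ∧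
    SMC.asymptoticVariance μ g K φ n ≤
      (1 + n * SMC.growthWithinMode μ F n * SMC.maxDensity g n /
        (1 - (1 - SMC.localGap μ K F hF n) ^ 2 * SMC.maxDensity g n)) * Var[φ; μ n] := by
  have hstep := SMC.isStep_maxDensity hg hμg hgb hK
  have hmodes := SMC.isModePartition_of_noMixing hF hFdisj hFcover hFpos hnomix
  refine ⟨SMC.tendstoInDistribution_scaledError hg hstep hφ hφ2 hφ0, ?_⟩
  rw [variance_of_integral_eq_zero hφ.aemeasurable hφ0]
  exact SMC.asymptoticVariance_le hg hstep hmodes hΓγ hφ hφ2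

theorem mainTheorem5 {E : Type*} [MeasurableSpace E] [StandardBorelSpace E]
    (n : ℕ) (hn : 1 ≤ n)
    -- the interpolating distributions (only the indices `0, …, n` matter)
    (μ : ℕ → Measure E) [∀ k, IsProbabilityMeasure (μ k)]
    -- `g k` is a version of `dμ_{k+1} / dμ_k`, bounded
    (g : ℕ → E → ℝ≥0) (hg : ∀ k, Measurable (g k))
    (hμg : ∀ k < n, μ (k + 1) = (μ k).withDensity fun x => (g k x : ℝ≥0∞))
    (hgb : ∀ k < n, BddAbove (Set.range fun x => (g k x : ℝ)))
    -- `K k` is a Markov kernel leaving `μ k` invariant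
    (K : ℕ → Kernel E E) [∀ k, IsMarkovKernel (K k)]
    (hK : ∀ k, 1 ≤ k → k ≤ n → Kernel.Invariant (K k) (μ k))
    -- the modes: a measurable partition, all modes having positive mass
    (m : ℕ) (F : Fin m → Set E) (hF : ∀ r, MeasurableSet (F r))
    (hFdisj : Pairwise fun r s => Disjoint (F r) (F s)) (hFcover : ⋃ r, F r = Set.univ)
    (hFpos : ∀ k, 1 ≤ k → k ≤ n → ∀ r, 0 < μ k (F r))
    -- no mixing between the modes
    (hnomix : ∀ k, 1 ≤ k → k ≤ n → ∀ r, ∀ x ∈ F r, K k x (F r) = 1)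
    (hΓγ : (1 - SMC.localGap μ K F hF n) ^ 2 * SMC.maxDensity g n < 1)
    -- the test function
    (φ : E → ℝ) (hφ : Measurable φ)
    (hφint : ∃ ε : ℝ, 0 < ε ∧ Integrable (fun x => |φ x| ^ (2 + ε)) (μ n))
    (hφ0 : ∫ x, φ x ∂(μ n) = 0) :
    TendstoInDistribution (fun N : ℕ => SMC.scaledError (μ n) φ N) atTop (id : ℝ → ℝ)
      (fun N : ℕ => SMC.particleLaw (μ 0) g hg K N n)
      (gaussianReal 0 (SMC.asymptoticVariance μ g K φ n).toNNReal) ∧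
    SMC.asymptoticVariance μ g K φ n ≤
      (1 + n * SMC.growthWithinMode μ F n * SMC.maxDensity g n /
        (1 - (1 - SMC.localGap μ K F hF n) ^ 2 * SMC.maxDensity g n)) * Var[φ; μ n] := by
  obtain ⟨ε, hε, hφε⟩ := hφint
  exact mainTheorem5_general n μ g hg hμg hgb K hK m F hF hFdisj hFcover hFpos hnomix hΓγ φ hφ
    (SMC.memLp_two_of_integrable_rpow hφ.aestronglyMeasurable hε.le hφε) hφ0
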